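/- Let $q$ be a prime power and let $A=(a_{ij})\in\mathbb F_q^{m\times k}$. Consider the linear system $$(\star)\qquad a_{i1}x_1+\cdots+a_{ik}x_k=0\qquad(1\le i\le m)$$ in variables $x_1,\dots,x_k\in\mathbb F_q^n$. Call two indices in $[k]=\{1,\dots,k\}$ equivalent if the corresponding columns of $A$ are nonzero scalar multiples of one another; the classes of this equivalence relation are the column equivalence classes. A set $C\subseteq[k]$ of indices is said to sum to zero if the columns of $A$ indexed by $C$ add up to the zero vector. Assume that: - $(\star)$ is of type (RC): it is balanced, i.e. $a_{i1}+\cdots+a_{ik}=0$ for every $i$, and it has at most one column equivalence class of size $1$; - $(\star)$ is non-degenerate: the rows of $A$ are linearly independent and no column of $A$ is zero; - $(\star)$ is irreducible: there is no linear system $(\star')$ such that each equation of $(\star)$ is a linear combination of the equations of $(\star')$ and vice versa, and such that the variables $x_1,\dots,x_k$ can be partitioned into two or more (nonempty) classes so that every equation of $(\star')$ only uses (with nonzero coefficient) variables from one class. Suppose that there is a partition $[k]=P_1\cup\cdots\cup P_{2s}$ into nonempty pairwise disjoint sets such that: 1. for all $r\in[s]$, the columns of $A$ indexed by $P_r\cup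 P_{s+r}$ sum to zero; 2. if $(b_1,\dots,b_k)\in\mathbb F_q^k\setminus\{0\}$ is a nonzero linear combination of the rows of $A$, then $\sum_{j\in P_r}b_j\neq0$ for at least two different values of $r\in[s]$; 3. if $C$ is a column equivalence class of size $2$ that sums to zero, then there is some $r\in[s]$ such that $C=P_r\cup P_{s+r}$. Then $(\star)$ is moderate: there exist real constants $\beta,\gamma>0$ with $\gamma<q$ such that, for every $n$, every subset $S\subseteq\mathbb F_q^n$ of size at least $\beta\cdot\gamma^n$ contains pairwise distinct elements $x_1,\dots,x_k\in S$ that satisfy $(\star)$. -/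

import Mathlib

namespace LinSys

/-- `x` is a solution in `F ^ n` of the homogeneous linear system with coefficient matrix `A`. -/
def IsSolution {F : Type*} [Field F] {m k n : ℕ} (A : Matrix (Fin m) (Fin k) F)
    (x : Fin k → Fin n → F) : Prop :=
  ∀ i, ∑ j, A i j • x j = 0

/-- A shape of the system: a solution whose entries are pairwise distinct. -/
def IsShape {F : Type*} [Field F] {m k n : ℕ} (A : Matrix (Fin m) (Fin k) F)
    (x : Fin k → Fin n → F) : Prop :=
  IsSolution A x ∧ Function.Injective x

/-- The system is moderate: for some `β, γ > 0` with `γ < q`, for all `n`, every subset of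
`F ^ n` with at least `β * γ ^ n` elements contains a shape. -/
def IsModerate {F : Type*} [Field F] [Fintype F] {m k : ℕ} (A : Matrix (Fin m) (Fin k) F) :
    Prop :=
  ∃ β γ : ℝ, 0 < β ∧ 0 < γ ∧ γ < (Fintype.card F : ℝ) ∧
    ∀ (n : ℕ) (S : Finset (Fin n → F)), β * γ ^ n ≤ (S.card : ℝ) →
      ∃ x : Fin k → Fin n → F, (∀ j, x j ∈ S) ∧ IsShape A x

/-- In every equation the coefficients sum to zero. -/
def IsBalanced {F : Type*} [Field F] {m k : ℕ} (A : Matrix (Fin m) (Fin k) F) : Prop :=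
  ∀ i, ∑ j, A i j = 0

/-- The set of linear combinations of the rows of `A`. -/
def rowSpace {F : Type*} [Field F] {m k : ℕ} (A : Matrix (Fin m) (Fin k) F) :
    Submodule F (Fin k → F) :=
  Submodule.span F (Set.range A.row)

/-- Two indices are equivalent if the corresponding columns of `A` are nonzero scalar multiples
of one another. -/
def columnSetoid {F : Type*} [Field F] {m k : ℕ} (A : Matrix (Fin m) (Fin k) F) :
    Setoid (Fin k) where
  r j j' := ∃ c : F, c ≠ 0 ∧ A.col j' = c • A.col j
  iseqv :=
    { refl := fun _ => ⟨1, one_ne_zero, (one_smul F _).symm⟩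
      symm := by
        rintro j j' ⟨c, hc, h⟩
        exact ⟨c⁻¹, inv_ne_zero hc, by rw [h, smul_smul, inv_mul_cancel₀ hc, one_smul]⟩
      trans := by
        rintro j j' j'' ⟨c, hc, h⟩ ⟨d, hd, h'⟩
        exact ⟨d * c, mul_ne_zero hd hc, by rw [h', h, smul_smul]⟩ }

/-- `C` is one of the column equivalence classes of `A`. -/
def IsColumnClass {F : Type*} [Field F] {m k : ℕ} (A : Matrix (Fin m) (Fin k) F)
    (C : Finset (Fin k)) : Prop :=
  (C : Set (Fin k)) ∈ (columnSetoid A).classes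

/-- The columns of `A` indexed by `C` add up to the zero vector. -/
def SumsToZero {F : Type*} [Field F] {m k : ℕ} (A : Matrix (Fin m) (Fin k) F)
    (C : Finset (Fin k)) : Prop :=
  ∑ j ∈ C, A.col j = 0

/-- Type (RC): balanced, with at most one column equivalence class of size `1`. -/
def IsTypeRC {F : Type*} [Field F] {m k : ℕ} (A : Matrix (Fin m) (Fin k) F) : Prop :=
  IsBalanced A ∧
    ∀ C C' : Finset (Fin k), IsColumnClass A C → IsColumnClass A C' →
      C.card = 1 → C'.card = 1 → C = C'

/-- The rows are linearly independent and every variable is used. -/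
def IsNondegenerate {F : Type*} [Field F] {m k : ℕ} (A : Matrix (Fin m) (Fin k) F) : Prop :=
  LinearIndependent F A.row ∧ ∀ j, ∃ i, A i j ≠ 0

/-- Equivalent systems: each equation of either system is a linear combination of the equations
of the other. -/
def IsEquivalent {F : Type*} [Field F] {m m' k : ℕ} (A : Matrix (Fin m) (Fin k) F)
    (A' : Matrix (Fin m') (Fin k) F) : Prop :=
  (∀ i, A.row i ∈ rowSpace A') ∧ (∀ i, A'.row i ∈ rowSpace A)

/-- `P 0, …, P (t - 1)` is a partition of the index set into `t` nonempty disjoint sets. -/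
def IsPartition {k t : ℕ} (P : Fin t → Finset (Fin k)) : Prop :=
  (∀ r, (P r).Nonempty) ∧ (∀ r r', r ≠ r' → Disjoint (P r) (P r')) ∧ ∀ j, ∃ r, j ∈ P r

/-- Reducible: equivalent to a system (with any number of equations) for which the variables can
be partitioned into two or more classes such that each equation uses variables of one class only. -/
def IsReducible {F : Type*} [Field F] {m k : ℕ} (A : Matrix (Fin m) (Fin k) F) : Prop :=
  ∃ (m' : ℕ) (A' : Matrix (Fin m') (Fin k) F), IsEquivalent A A' ∧
    ∃ (t : ℕ) (Q : Fin t → Finset (Fin k)), 2 ≤ t ∧ IsPartition Q ∧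
      ∀ i, ∃ c, ∀ j, A' i j ≠ 0 → j ∈ Q c

end LinSys

/-! A solution with repeated entries comes first; its entries are then made distinct inside each
column class.

Repeated entries: put x_j = y_r on P_r and x_j = z_r on P_{s+r}. Since the columns in P_r ∪ P_{s+r}
cancel, (⋆) becomes Σ_r B_r (y_r - z_r) = 0, where B_r is the sum of the columns in P_r, r ≤ s.
Condition 2 keeps unit vectors out of the row space of B, so ker B lies in no coordinate hyperplane,
and over an extension K of degree s it contains a vector v without zero entries. It suffices that
y_r - z_r = v_r u for one u ≠ 0, which is s - 1 equations in 2s unknowns over K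
(`exists_differences_proportional`). As 2(s - 1) < 2s, the polynomial method applies
(`exists_submodule_sum_eq_zero`): products of functions from a space H of small codimension are
orthogonal to the solution indicator. If u = 0 were forced, this sum could be made a power of a
bilinear pairing that does not vanish on H.

Distinct entries: `exists_pairRich_chain` gives S = T_0 ⊇ … ⊇ T_k with T_k still large, such that
combinations c x + d y over T_{i+1} have many representations over T_i. The first solution is taken
in T_k. Columns in one class are proportional, so a class only has to preserve one combination Σ c_j
x_j while pairs are exchanged (`exists_injOn_of_two_le_card`). The obstruction is c x - c x in a
class of size 2; by condition 3 that class is P_r ∪ P_{s+r}, where y_r ≠ z_r. The class of size 1,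
if any, keeps its entry. -/

/-! ### The polynomial method -/

open Finset in
/-- An exponential tail bound for the number of exponent vectors of small degree. -/
theorem exists_card_sum_le_pow (Q : ℕ) (hQ : 2 ≤ Q) (θ : ℝ) (hθ : θ < 1 / 2) :
    ∃ γ : ℝ, 0 < γ ∧ γ < Q ∧ ∀ n D : ℕ, (D : ℝ) ≤ θ * (Q - 1) * n →
      ((univ.filter fun e : Fin n → Fin Q => ∑ i, (e i : ℕ) ≤ D).card : ℝ) ≤ γ ^ n := by
  set c : ℝ := θ * (Q - 1) with hc
  have hQ' : (2 : ℝ) ≤ Q := by exact_mod_cast hQ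
  let f : ℝ → ℝ := fun t => ∑ i : Fin Q, Real.exp (t * (c - (i : ℕ)))
  have hf0 : f 0 = Q := by simp [f]
  have hd : HasDerivAt f (∑ i : Fin Q, (c - (i : ℕ))) 0 := by
    have : ∀ i ∈ (univ : Finset (Fin Q)),
        HasDerivAt (fun t : ℝ => Real.exp (t * (c - (i : ℕ)))) (c - (i : ℕ)) 0 := by
      intro i _
      simpa using ((hasDerivAt_id (0 : ℝ)).mul_const (c - ((i : ℕ) : ℝ))).exp
    exact HasDerivAt.fun_sum this
  have hsum : ∑ i : Fin Q, (c - ((i : ℕ) : ℝ)) = Q * c - Q * (Q - 1) / 2 := by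
    rw [sum_sub_distrib, Fin.sum_univ_eq_sum_range (fun i => (i : ℝ))]
    have h := Finset.sum_range_id_mul_two Q
    have h2 : (∑ i ∈ range Q, (i : ℝ)) * 2 = Q * (Q - 1) := by
      have := congrArg (Nat.cast : ℕ → ℝ) h
      push_cast [Nat.cast_sub (by omega : 1 ≤ Q)] at this
      exact this
    simp only [sum_const, card_univ, Fintype.card_fin, nsmul_eq_mul]
    linarith
  have hneg : ∑ i : Fin Q, (c - ((i : ℕ) : ℝ)) < 0 := by
    rw [hsum, hc]
    have : (0 : ℝ) < Q * (Q - 1) := by nlinarith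
    nlinarith
  -- Chernoff's argument: `c` is below the mean (Q - 1)/2 of the exponents, so `f` decreases at 0
  -- and some `f t` with t > 0 is below Q. This value is γ.
  obtain ⟨t, ht0, ht⟩ : ∃ t : ℝ, 0 < t ∧ f t < f 0 := by
    have h1 := (hasDerivAt_iff_tendsto_slope.1 hd).eventually (gt_mem_nhds hneg)
    have h2 : ∀ᶠ t in nhdsWithin (0 : ℝ) (Set.Ioi 0), slope f 0 t < 0 :=
      h1.filter_mono (nhdsWithin_mono _ fun x hx => ne_of_gt hx)
    obtain ⟨t, ht, ht0⟩ := (h2.and self_mem_nhdsWithin).exists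
    have ht0 : 0 < t := ht0
    refine ⟨t, ht0, ?_⟩
    rw [slope_def_field, sub_zero, div_lt_iff₀ ht0] at ht
    linarith
  refine ⟨f t, ?_, hf0 ▸ ht, fun n D hD => ?_⟩
  · have : Nonempty (Fin Q) := ⟨⟨0, by omega⟩⟩
    exact sum_pos (fun i _ => Real.exp_pos _) univ_nonempty
  · calc ((univ.filter fun e : Fin n → Fin Q => ∑ i, (e i : ℕ) ≤ D).card : ℝ)
        = ∑ e ∈ univ.filter fun e : Fin n → Fin Q => ∑ i, (e i : ℕ) ≤ D, 1 := by simp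
      _ ≤ ∑ e ∈ univ.filter fun e : Fin n → Fin Q => ∑ i, (e i : ℕ) ≤ D,
            ∏ i, Real.exp (t * (c - (e i : ℕ))) := by
          refine sum_le_sum fun e he => ?_
          rw [← Real.exp_sum, ← mul_sum, sum_sub_distrib]
          refine Real.one_le_exp (mul_nonneg ht0.le ?_)
          have : ((∑ i, (e i : ℕ) : ℕ) : ℝ) ≤ D := by exact_mod_cast (mem_filter.1 he).2
          push_cast at this
          simp only [sum_const, card_univ, Fintype.card_fin, nsmul_eq_mul]
          linarith
      _ ≤ ∑ e : Fin n → Fin Q, ∏ i, Real.exp (t * (c - (e i : ℕ))) :=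
          sum_le_sum_of_subset_of_nonneg (filter_subset _ _)
            fun _ _ _ => prod_nonneg fun _ _ => (Real.exp_pos _).le
      _ = f t ^ n := by
          rw [Fintype.sum_pow]

/-- On a finite field every power function is given by an exponent less than the cardinality. -/
theorem FiniteField.exists_reduced_exponent (K : Type*) [Field K] [Fintype K] (d : ℕ) :
    ∃ e : Fin (Fintype.card K), (e : ℕ) ≤ d ∧ ∀ x : K, x ^ (e : ℕ) = x ^ d := by
  induction d using Nat.strong_induction_on with
  | _ d ih =>
    by_cases hd : d < Fintype.card K
    · exact ⟨⟨d, hd⟩, le_rfl, fun x => rfl⟩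
    · push Not at hd
      have h1 : 1 < Fintype.card K := Fintype.one_lt_card
      obtain ⟨e, he, hx⟩ := ih (d - Fintype.card K + 1) (by omega)
      refine ⟨e, by omega, fun x => ?_⟩
      rw [hx, pow_succ]
      conv_rhs => rw [← Nat.sub_add_cancel hd, pow_add, FiniteField.pow_card]

open Finset MvPolynomial in
/-- The indicator function of the solution set of a linear system, as a polynomial. -/
theorem exists_indicator_mvPolynomial {K : Type*} [Field K] [Fintype K] [DecidableEq K]
    {ι ε : Type*} [Fintype ι] [Fintype ε] (a : ε → ι → K) (n : ℕ) :
    ∃ P : MvPolynomial (ι × Fin n) K,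
      P.totalDegree ≤ Fintype.card ε * (n * (Fintype.card K - 1)) ∧
      ∀ x : ι → Fin n → K, eval (fun z => x z.1 z.2) P =
        if ∀ e, ∑ p, a e p • x p = 0 then 1 else 0 := by
  refine ⟨∏ e, ∏ i : Fin n, (1 - (∑ p, C (a e p) * X (p, i)) ^ (Fintype.card K - 1)), ?_, ?_⟩
  · refine (totalDegree_finsetProd _ _).trans ?_
    refine (sum_le_card_nsmul _ _ (n * (Fintype.card K - 1)) fun e _ => ?_).trans (by simp)
    refine (totalDegree_finsetProd _ _).trans ?_
    refine (sum_le_card_nsmul _ _ (Fintype.card K - 1) fun i _ => ?_).trans (by simp)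
    refine (totalDegree_sub _ _).trans (max_le (by simp) ?_)
    refine (totalDegree_pow _ _).trans ?_
    have : (∑ p, C (a e p) * X (p, i) : MvPolynomial (ι × Fin n) K).totalDegree ≤ 1 := by
      refine totalDegree_finsetSum_le fun p _ => ?_
      refine (totalDegree_mul _ _).trans ?_
      simp
    exact (Nat.mul_le_mul_left _ this).trans (by simp)
  · intro x
    simp only [map_prod, map_sub, map_one, map_pow, map_sum, map_mul, eval_C, eval_X]
    have hq : Fintype.card K - 1 ≠ 0 := by have := Fintype.one_lt_card (α := K); omega
    split_ifs with h
    · refine prod_eq_one fun e _ => prod_eq_one fun i _ => ?_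
      have := congrFun (h e) i
      simp only [Finset.sum_apply, Pi.smul_apply, smul_eq_mul, Pi.zero_apply] at this
      rw [this, zero_pow hq, sub_zero]
    · push Not at h
      obtain ⟨e, he⟩ := h
      obtain ⟨i, hi⟩ := Function.ne_iff.1 he
      simp only [Finset.sum_apply, Pi.smul_apply, smul_eq_mul, Pi.zero_apply] at hi
      refine prod_eq_zero (mem_univ e) (prod_eq_zero (mem_univ i) ?_)
      rw [FiniteField.pow_card_sub_one_eq_one _ hi, sub_self]

open Finset MvPolynomial in
/-- The polynomial method: functions on `S` orthogonal to all monomials of low degree annihilate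
the solution indicator of every system with more than twice as many variables as equations. -/
theorem exists_submodule_sum_eq_zero (K : Type*) [Field K] [Fintype K] [DecidableEq K]
    (ι ε : Type*) [Fintype ι] [Fintype ε] [DecidableEq ι]
    (hcard : 2 * Fintype.card ε < Fintype.card ι) :
    ∃ γ : ℝ, 0 < γ ∧ γ < Fintype.card K ∧
      ∀ (a : ε → ι → K) (n : ℕ) (S : Finset (Fin n → K)),
        ∃ H : Submodule K (S → K), (S.card : ℝ) ≤ Module.finrank K H + γ ^ n ∧
          ∀ h : ι → S → K, (∀ p, h p ∈ H) →
            ∑ x : ι → S, (if ∀ e, ∑ p, a e p • (x p : Fin n → K) = 0 then (1 : K) else 0) *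
              ∏ p, h p (x p) = 0 := by
  have hι : 0 < Fintype.card ι := by omega
  have hιR : (0 : ℝ) < Fintype.card ι := by exact_mod_cast hι
  have hq := Fintype.one_lt_card (α := K)
  obtain ⟨γ, hγ0, hγ, hcount⟩ := exists_card_sum_le_pow (Fintype.card K) hq
    (Fintype.card ε / Fintype.card ι : ℝ) (by
      rw [div_lt_div_iff₀ hιR two_pos]
      have : ((2 * Fintype.card ε : ℕ) : ℝ) < Fintype.card ι := by exact_mod_cast hcard
      push_cast at this
      linarith)
  refine ⟨γ, hγ0, hγ, fun a n S => ?_⟩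
  set N := Fintype.card ε * (n * (Fintype.card K - 1)) with hN
  set D := N / Fintype.card ι with hD
  let E := univ.filter fun e : Fin n → Fin (Fintype.card K) => ∑ i, (e i : ℕ) ≤ D
  -- H is the kernel of the moments against reduced monomials of degree at most `D`, so its
  -- codimension is at most the number of these monomials.
  let Φ : (S → K) →ₗ[K] (E → K) :=
    { toFun := fun h e => ∑ y : S, h y * ∏ i, (y : Fin n → K) i ^ (e.1 i : ℕ)
      map_add' := fun g h => by
        funext e; simp only [Pi.add_apply, add_mul, sum_add_distrib]
      map_smul' := fun c h => by
        funext e; simp only [Pi.smul_apply, smul_eq_mul, mul_assoc, mul_sum, RingHom.id_apply] }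
  have hEcard : (E.card : ℝ) ≤ γ ^ n := by
    refine hcount n D ?_
    have h1 : D * Fintype.card ι ≤ N := Nat.div_mul_le_self _ _
    have h2 : (D : ℝ) * Fintype.card ι ≤ N := by exact_mod_cast h1
    rw [hN] at h2
    push_cast [Nat.cast_sub hq.le] at h2
    have h3 := (le_div_iff₀ hιR).2 h2
    calc (D : ℝ) ≤ _ := h3
      _ = _ := by ring
  refine ⟨LinearMap.ker Φ, ?_, fun h hh => ?_⟩
  · have h1 := LinearMap.finrank_range_add_finrank_ker Φ
    have h2 : Module.finrank K (LinearMap.range Φ) ≤ E.card := by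
      refine (Submodule.finrank_le _).trans ?_
      simp
    have h3 : Module.finrank K (S → K) = S.card := by simp
    have h4 : S.card ≤ E.card + Module.finrank K (LinearMap.ker Φ) := by omega
    have h5 : (S.card : ℝ) ≤ E.card + Module.finrank K (LinearMap.ker Φ) := by exact_mod_cast h4
    linarith
  · obtain ⟨P, hPdeg, hP⟩ := exists_indicator_mvPolynomial a n
    have hexp : ∀ x : ι → S,
        (if ∀ e, ∑ p, a e p • (x p : Fin n → K) = 0 then (1 : K) else 0) * ∏ p, h p (x p) =
        ∑ d ∈ P.support, coeff d P *
          ∏ p, (h p (x p) * ∏ i, (x p : Fin n → K) i ^ d (p, i)) := by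
      intro x
      rw [← hP fun p => (x p : Fin n → K), eval_eq', sum_mul]
      refine sum_congr rfl fun d _ => ?_
      rw [Fintype.prod_prod_type, prod_mul_distrib]
      ring
    simp only [hexp]
    rw [sum_comm]
    refine sum_eq_zero fun d hd => ?_
    rw [← mul_sum]
    have hprod : ∑ x : ι → S, ∏ p, (h p (x p) * ∏ i, (x p : Fin n → K) i ^ d (p, i)) =
        ∏ p, ∑ y : S, h p y * ∏ i, (y : Fin n → K) i ^ d (p, i) := by
      rw [prod_univ_sum, Fintype.piFinset_univ]
    rw [hprod]
    have hdeg : ∑ p, ∑ i, d (p, i) ≤ N := by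
      have h1 := (le_totalDegree hd).trans hPdeg
      rwa [Finsupp.sum_fintype _ _ (fun _ => rfl), Fintype.sum_prod_type] at h1
    -- A monomial of degree at most `N` spreads over |ι| blocks of variables. One block has degree
    -- at most N / |ι|, and its factor is a moment that vanishes on H.
    obtain ⟨p, hp⟩ : ∃ p, ∑ i, d (p, i) ≤ D := by
      by_contra hcon
      push Not at hcon
      have h1 : Fintype.card ι * (D + 1) ≤ ∑ p, ∑ i, d (p, i) := by
        have := card_nsmul_le_sum univ (fun p => ∑ i, d (p, i)) (D + 1) fun p _ => hcon p
        simpa using this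
      have h2 := Nat.lt_mul_div_succ N hι
      rw [← hD] at h2
      omega
    refine mul_eq_zero_of_right _ (prod_eq_zero (mem_univ p) ?_)
    choose e he hx using fun i => FiniteField.exists_reduced_exponent K (d (p, i))
    have heE : e ∈ E := mem_filter.2 ⟨mem_univ _, (sum_le_sum fun i _ => he i).trans hp⟩
    have hker := congrFun (LinearMap.mem_ker.1 (hh p)) ⟨e, heE⟩
    simp only [Φ, LinearMap.coe_mk, AddHom.coe_mk, Pi.zero_apply, hx] at hker
    exact hker

/-! ### Linear algebra of function spaces -/

open Finset in
/-- A space of functions contains a function whose support is at least as large as its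
dimension. -/
theorem Submodule.exists_finrank_le_card_support {K α : Type*} [Field K] [DecidableEq K] [Fintype α]
    (H : Submodule K (α → K)) :
    ∃ h ∈ H, Module.finrank K H ≤ (univ.filter fun x => h x ≠ 0).card := by
  classical
  let B : ℕ → Prop := fun c => ∃ h ∈ H, (univ.filter fun x => h x ≠ 0).card = c
  have hB : ∃ c, B c := ⟨_, 0, H.zero_mem, rfl⟩
  have hbd : ∀ c, B c → c ≤ Fintype.card α := by
    rintro c ⟨h, -, rfl⟩
    exact card_le_univ _
  obtain ⟨c, ⟨h, hH, hc⟩, hmax⟩ : ∃ c, B c ∧ ∀ c', B c' → c' ≤ c := by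
    obtain ⟨c0, hc0⟩ := hB
    exact ⟨Nat.findGreatest B (Fintype.card α), Nat.findGreatest_spec (hbd c0 hc0) hc0,
      fun c' h' => Nat.le_findGreatest (hbd c' h') h'⟩
  refine ⟨h, hH, ?_⟩
  by_contra hlt
  push Not at hlt
  set T := univ.filter fun x => h x ≠ 0 with hT
  -- If a maximal support `T` were smaller than dim H, some nonzero element of H would vanish on
  -- `T`, and adding it to `h` would enlarge the support.
  let Φ : H →ₗ[K] (T → K) := (LinearMap.funLeft K K (Subtype.val : T → α)).comp H.subtype
  have hker : LinearMap.ker Φ ≠ ⊥ := by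
    refine LinearMap.ker_ne_bot_of_finrank_lt ?_
    simpa using hlt
  obtain ⟨g, hg, hg0⟩ := Submodule.exists_mem_ne_zero_of_ne_bot hker
  have hgT : ∀ x, h x ≠ 0 → (g : α → K) x = 0 := fun x hx => by
    have := congrFun (LinearMap.mem_ker.1 hg) ⟨x, mem_filter.2 ⟨mem_univ _, hx⟩⟩
    simpa [Φ, LinearMap.funLeft_apply] using this
  have hg0' : (g : α → K) ≠ 0 := fun h0 => hg0 (Subtype.ext h0)
  obtain ⟨x0, hx0⟩ := Function.ne_iff.1 hg0'
  have hss : T ⊂ univ.filter fun x => (h + (g : α → K)) x ≠ 0 := by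
    rw [ssubset_iff_of_subset]
    · refine ⟨x0, ?_, ?_⟩
      · have : h x0 = 0 := by
          by_contra h0
          exact hx0 (hgT x0 h0)
        simpa [this] using hx0
      · intro hx
        exact hx0 (hgT x0 (mem_filter.1 hx).2)
    · intro x hx
      have hx' := (mem_filter.1 hx).2
      simpa [hgT x hx'] using hx'
  have h1 := hmax _ ⟨h + g, H.add_mem hH g.2, rfl⟩
  have h2 := card_lt_card hss
  omega

open Finset in
/-- A weighted bilinear pairing is nonzero on every space of small codimension. -/
theorem Submodule.exists_sum_mul_ne_zero {K α : Type*} [Field K] [DecidableEq K] [Fintype α]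
    (H : Submodule K (α → K)) (g : α → K)
    (hg : 2 * (Fintype.card α - Module.finrank K H) < (univ.filter fun x => g x ≠ 0).card) :
    ∃ h ∈ H, ∃ h' ∈ H, ∑ x, g x * h x * h' x ≠ 0 := by
  classical
  by_contra hcon
  push Not at hcon
  let Ψ : (α → K) →ₗ[K] Module.Dual K (α → K) :=
    { toFun := fun f => Fintype.linearCombination K (fun x => g x * f x)
      map_add' := fun f f' => by
        ext i; simp [mul_add]
      map_smul' := fun c f => by
        ext i; simp [mul_left_comm] }
  have hΨ : ∀ f h, Ψ f h = ∑ x, g x * f x * h x := fun f h => by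
    simp [Ψ, Fintype.linearCombination_apply, mul_comm]
  -- If the pairing vanishes on H, the image of H has dimension at most codim H, and the kernel
  -- lives on the zeros of `g`. Hence the support of `g` has at most 2 codim H elements.
  have hle : H.map Ψ ≤ H.dualAnnihilator := by
    rintro _ ⟨f, hf, rfl⟩
    rw [Submodule.mem_dualAnnihilator]
    intro h hh
    rw [hΨ]
    exact hcon f hf h hh
  have h1 := Submodule.finrank_mono hle
  have h2 := Subspace.finrank_add_finrank_dualAnnihilator_eq H
  rw [Module.finrank_fintype_fun_eq_card] at h2
  let Θ : H →ₗ[K] Module.Dual K (α → K) := Ψ.comp H.subtype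
  have h3 := LinearMap.finrank_range_add_finrank_ker Θ
  have h4 : LinearMap.range Θ = H.map Ψ := by
    rw [LinearMap.range_comp, Submodule.range_subtype]
  rw [h4] at h3
  let T := univ.filter fun x => g x = 0
  let res : LinearMap.ker Θ →ₗ[K] (T → K) :=
    (LinearMap.funLeft K K (Subtype.val : T → α)).comp (H.subtype.comp (LinearMap.ker Θ).subtype)
  have hinj : Function.Injective res := by
    have hz : ∀ f : LinearMap.ker Θ, ∀ x, g x ≠ 0 → (f.1 : α → K) x = 0 := by
      intro f x hx
      have h5 : Ψ (f.1 : α → K) = 0 := LinearMap.mem_ker.1 f.2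
      have h6 := hΨ (f.1 : α → K) (Pi.single x 1)
      rw [h5] at h6
      simpa [Pi.single_apply, hx] using h6.symm
    intro f f' hff
    refine Subtype.ext (Subtype.ext (funext fun x => ?_))
    by_cases hx : g x = 0
    · exact congrFun hff ⟨x, mem_filter.2 ⟨mem_univ _, hx⟩⟩
    · rw [hz f x hx, hz f' x hx]
  have h5 := LinearMap.finrank_le_finrank_of_injective hinj
  have h6 : Module.finrank K (T → K) = T.card := by simp
  have h7 : T.card + (univ.filter fun x => g x ≠ 0).card = Fintype.card α :=
    card_filter_add_card_filter_not _
  omega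

/-! ### Solutions with repeated entries -/

open Finset in
/-- A large set contains pairs whose differences are prescribed nonzero multiples of a common
nonzero vector. -/
theorem exists_differences_proportional (K : Type*) [Field K] [Fintype K] [DecidableEq K] (s : ℕ) :
    ∃ γ : ℝ, 0 < γ ∧ γ < Fintype.card K ∧
      ∀ (v : Fin (s + 1) → K), (∀ r, v r ≠ 0) → ∀ (n : ℕ) (S : Finset (Fin n → K)),
        2 * γ ^ n < S.card →
        ∃ y z : Fin (s + 1) → Fin n → K, (∀ r, y r ∈ S ∧ z r ∈ S) ∧
          ∃ u ≠ 0, ∀ r, y r - z r = v r • u := by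
  obtain ⟨γ, hγ0, hγ, hmain⟩ := exists_submodule_sum_eq_zero K (Fin (s + 1) ⊕ Fin (s + 1)) (Fin s)
    (by simp only [Fintype.card_fin, Fintype.card_sum]; omega)
  refine ⟨γ, hγ0, hγ, fun v hv n S hS => ?_⟩
  -- Equation `e` says that d_{e+1} / v_{e+1} = d_0 / v_0, the common value being `u`.
  let b : Fin s → Fin (s + 1) → K := fun e r =>
    if r = e.succ then (v r)⁻¹ else if r = 0 then -(v r)⁻¹ else 0
  have hb : ∀ (e : Fin s) (d : Fin (s + 1) → Fin n → K),
      ∑ r, b e r • d r = (v e.succ)⁻¹ • d e.succ - (v 0)⁻¹ • d 0 := by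
    intro e d
    have hne : (0 : Fin (s + 1)) ≠ e.succ := (Fin.succ_ne_zero e).symm
    rw [Fin.sum_univ_succ, sum_eq_single e]
    · simp only [b, hne, if_true, if_false]
      rw [neg_smul]; abel
    · intro e' _ hne'
      simp [b, hne']
    · simp
  obtain ⟨H, hH, hsum⟩ := hmain (fun e => Sum.elim (b e) fun r => -b e r) n S
  by_contra hcon
  push Not at hcon
  have hiff : ∀ x : Fin (s + 1) ⊕ Fin (s + 1) → S,
      (∀ e, ∑ p, (Sum.elim (b e) fun r => -b e r) p • (x p : Fin n → K) = 0) ↔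
        ∀ r, x (Sum.inl r) = x (Sum.inr r) := by
    intro x
    have hrw : ∀ e, ∑ p, (Sum.elim (b e) fun r => -b e r) p • (x p : Fin n → K) =
        ∑ r, b e r • ((x (Sum.inl r) : Fin n → K) - x (Sum.inr r)) := by
      intro e
      rw [Fintype.sum_sum_type, ← sum_add_distrib]
      refine sum_congr rfl fun r _ => ?_
      simp only [Sum.elim_inl, Sum.elim_inr]
      rw [neg_smul, smul_sub, sub_eq_add_neg]
    simp only [hrw, hb]
    constructor
    · intro h
      set u := (v 0)⁻¹ • ((x (Sum.inl 0) : Fin n → K) - x (Sum.inr 0)) with hu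
      have hall : ∀ r, (x (Sum.inl r) : Fin n → K) - x (Sum.inr r) = v r • u := by
        intro r
        refine Fin.cases ?_ (fun e => ?_) r
        · rw [hu, smul_smul, mul_inv_cancel₀ (hv 0), one_smul]
        · rw [← sub_eq_zero.1 (h e), smul_smul, mul_inv_cancel₀ (hv _), one_smul]
      have hu0 : u = 0 := by
        by_contra hu0
        obtain ⟨r, hr⟩ := hcon (fun r => x (Sum.inl r)) (fun r => x (Sum.inr r))
          (fun r => ⟨(x _).2, (x _).2⟩) u hu0
        exact hr (hall r)
      intro r
      have := hall r
      rw [hu0, smul_zero] at this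
      exact Subtype.ext (sub_eq_zero.1 this)
    · intro h e
      simp [h]
  have hS' : 2 * (Fintype.card S - Module.finrank K H) <
      (univ.filter fun _ : S => (1 : K) ≠ 0).card := by
    have h1 : Module.finrank K H ≤ S.card := by
      simpa using Submodule.finrank_le H
    have h2 : 2 * ((S.card : ℝ) - Module.finrank K H) < S.card := by linarith
    rw [← Nat.cast_sub h1] at h2
    simpa using (by exact_mod_cast h2 : 2 * (S.card - Module.finrank K H) < S.card)
  obtain ⟨h, hh, h', hh', hne⟩ := H.exists_sum_mul_ne_zero (fun _ => 1) hS'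
  have hzero := hsum (Sum.elim (fun _ => h) fun _ => h') (by rintro (r | r) <;> simp [hh, hh'])
  simp only [hiff] at hzero
  -- Only the solutions with equal left and right entries remain, so the sum factors over `r` into
  -- equal pairings.
  have hpow : (∑ x : S, 1 * h x * h' x) ^ (s + 1) = 0 := by
    rw [← Fintype.card_fin (s + 1), ← card_univ, ← prod_const, prod_univ_sum,
      Fintype.piFinset_univ, ← hzero, ← (Equiv.sumArrowEquivProdArrow _ _ _).symm.sum_comp,
      Fintype.sum_prod_type]
    refine sum_congr rfl fun y _ => ?_
    rw [sum_eq_single y]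
    · simp [Equiv.sumArrowEquivProdArrow, prod_mul_distrib, Fintype.prod_sum_type]
    · intro z _ hz
      rw [if_neg, zero_mul]
      intro heq
      exact hz (funext fun r => (heq r).symm)
    · simp
  exact hne (pow_eq_zero_iff (by omega) |>.1 hpow)

open Finset in
/-- A large set contains a nontrivial solution of a balanced three-variable equation. -/
theorem exists_weighted_mean (K : Type*) [Field K] [Fintype K] [DecidableEq K] :
    ∃ γ : ℝ, 0 < γ ∧ γ < Fintype.card K ∧
      ∀ c d : K, c ≠ 0 → d ≠ 0 → c + d ≠ 0 → ∀ (n : ℕ) (S : Finset (Fin n → K)),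
        3 * γ ^ n < S.card →
        ∃ x ∈ S, ∃ y ∈ S, ∃ z ∈ S, x ≠ y ∧ c • x + d • y = (c + d) • z := by
  obtain ⟨γ, hγ0, hγ, hmain⟩ := exists_submodule_sum_eq_zero K (Fin 3) Unit (by simp)
  refine ⟨γ, hγ0, hγ, fun c d hc hd hcd n S hS => ?_⟩
  obtain ⟨H, hH, hsum⟩ := hmain (fun _ => ![c, d, -(c + d)]) n S
  by_contra hcon
  push Not at hcon
  have hiff : ∀ x : Fin 3 → S,
      (∀ e : Unit, ∑ p, (![c, d, -(c + d)] : Fin 3 → K) p • (x p : Fin n → K) = 0) ↔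
        x 1 = x 0 ∧ x 2 = x 0 := by
    intro x
    simp only [Fin.sum_univ_three, Matrix.cons_val_zero, Matrix.cons_val_one, Matrix.cons_val,
      neg_smul, forall_const, ← sub_eq_add_neg, sub_eq_zero]
    constructor
    · intro h
      have h01 : (x 0 : Fin n → K) = x 1 := by
        by_contra hne
        exact hcon _ (x 0).2 _ (x 1).2 _ (x 2).2 hne h
      rw [← h01, ← add_smul] at h
      exact ⟨Subtype.ext h01.symm, Subtype.ext (smul_right_injective _ hcd h).symm⟩
    · rintro ⟨h1, h2⟩
      rw [h1, h2, add_smul]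
  have h1 : Module.finrank K H ≤ S.card := by
    simpa using Submodule.finrank_le H
  -- With only constant solutions the sum is Σ g h h'. The weight `g` must itself lie in H, and |S|
  -- > 3γ^n makes its support exceed 2 codim H.
  obtain ⟨g, hgH, hg⟩ := H.exists_finrank_le_card_support
  have hS' : 2 * (Fintype.card S - Module.finrank K H) <
      (univ.filter fun x : S => g x ≠ 0).card := by
    refine lt_of_lt_of_le ?_ hg
    have h2 : 2 * ((S.card : ℝ) - Module.finrank K H) < Module.finrank K H := by linarith
    rw [← Nat.cast_sub h1] at h2
    simpa using (by exact_mod_cast h2 : 2 * (S.card - Module.finrank K H) < Module.finrank K H)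
  obtain ⟨h, hh, h', hh', hne⟩ := H.exists_sum_mul_ne_zero g hS'
  have hzero := hsum ![g, h, h'] (by
    intro p; fin_cases p <;> simp [hgH, hh, hh'])
  simp only [hiff] at hzero
  refine hne (Eq.trans ?_ hzero)
  refine sum_bij_ne_zero (fun x _ _ => fun _ => x) (by simp)
    (fun x _ _ y _ _ hxy => congrFun hxy 0) ?_ ?_
  · intro x _ hx
    have hx' : x 1 = x 0 ∧ x 2 = x 0 := by
      by_contra hx'
      simp [hx'] at hx
    have hx0 : (fun _ => x 0) = x := by
      funext p
      fin_cases p <;> simp [hx']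
    refine ⟨x 0, mem_univ _, ?_, hx0⟩
    rw [← hx0] at hx
    simpa [Fin.prod_univ_three] using hx
  · intro x _ _
    simp [Fin.prod_univ_three]

open Finset in
/-- If every coordinate is nonzero somewhere on the kernel of `B`, then every large set contains
pairs of distinct elements, one for each column, whose differences form a solution of `B`. -/
theorem exists_pairs_of_forall_exists_kernel {F : Type*} [Field F] [Fintype F] {m s : ℕ}
    (B : Matrix (Fin m) (Fin s) F)
    (hB : ∀ r, ∃ w : Fin s → F, (∀ i, ∑ r', B i r' * w r' = 0) ∧ w r ≠ 0) :
    ∃ β γ : ℝ, 0 < β ∧ 0 < γ ∧ γ < Fintype.card F ∧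
      ∀ (n : ℕ) (S : Finset (Fin n → F)), β * γ ^ n ≤ S.card →
        ∃ y z : Fin s → Fin n → F, (∀ r, y r ∈ S ∧ z r ∈ S ∧ y r ≠ z r) ∧
          ∀ i, ∑ r, B i r • (y r - z r) = 0 := by
  classical
  rcases s with _ | s
  · refine ⟨1, 1, one_pos, one_pos, by exact_mod_cast Fintype.one_lt_card, fun n S _ => ?_⟩
    exact ⟨Fin.elim0, Fin.elim0, fun r => r.elim0, fun i => by simp⟩
  obtain ⟨p, hp⟩ := CharP.exists F
  have : Fact p.Prime := ⟨CharP.char_is_prime F p⟩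
  let K := FiniteField.Extension F p (s + 1)
  let : Fintype K := Fintype.ofFinite K
  have hfin : Module.finrank F K = s + 1 := FiniteField.finrank_extension F p (s + 1)
  let b : Module.Basis (Fin (s + 1)) F K := Module.finBasisOfFinrankEq F K hfin
  choose w hwker hw using hB
  -- Kernel vectors that are nonzero at different coordinates are combined along a basis of K;
  -- independence over F prevents cancellation in any entry.
  let v : Fin (s + 1) → K := fun r => ∑ r', w r' r • b r'
  have hv : ∀ r, v r ≠ 0 := fun r h0 =>
    hw r (Fintype.linearIndependent_iff.1 b.linearIndependent (fun r' => w r' r) h0 r)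
  have hvker : ∀ i, ∑ r, B i r • v r = 0 := by
    intro i
    simp only [v, smul_sum, smul_smul]
    rw [sum_comm]
    refine sum_eq_zero fun r' _ => ?_
    rw [← sum_smul, hwker, zero_smul]
  obtain ⟨γ₀, hγ₀, hγ₀lt, hmain⟩ := exists_differences_proportional K s
  have hcardK : (Fintype.card K : ℝ) = (Fintype.card F : ℝ) ^ (s + 1) := by
    rw [Module.card_eq_pow_finrank (K := F) (V := K), hfin]
    push_cast
    rfl
  have hq : (1 : ℝ) < Fintype.card F := by exact_mod_cast Fintype.one_lt_card
  -- The bound 1 ensures γ ≥ 1, so rounding n / (s + 1) costs only a constant factor when F^n is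
  -- embedded in K^{n'}.
  set g := max γ₀ 1 with hg
  have hg1 : 1 ≤ g := le_max_right _ _
  have hglt : g < (Fintype.card F : ℝ) ^ (s + 1) := by
    rw [← hcardK]
    refine max_lt hγ₀lt ?_
    rw [hcardK]
    exact one_lt_pow₀ hq (by omega)
  obtain ⟨γ, hγ1, hγ⟩ : ∃ γ : ℝ, 1 ≤ γ ∧ γ ^ (s + 1) = g := by
    refine ⟨g ^ ((s + 1 : ℕ) : ℝ)⁻¹, Real.one_le_rpow hg1 (by positivity), ?_⟩
    exact Real.rpow_inv_natCast_pow (by linarith) (by omega)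
  refine ⟨2 * g + 1, γ, by linarith, by linarith, ?_, fun n S hS => ?_⟩
  · refine lt_of_pow_lt_pow_left₀ (s + 1) (by positivity) ?_
    rwa [hγ]
  set n' := n / (s + 1) + 1 with hn'
  have hnn : n < n' * (s + 1) := by
    rw [hn', mul_comm]
    exact Nat.lt_mul_div_succ n (by omega)
  obtain ⟨φ, hφ⟩ : ∃ φ : (Fin n → F) →ₗ[F] (Fin n' → K), Function.Injective φ := by
    refine Module.Free.exists_linearMap_injective_of_lift_rank_lt ?_
    rw [← Module.finrank_eq_rank, ← Module.finrank_eq_rank, Cardinal.lift_natCast,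
      Cardinal.lift_natCast, Nat.cast_lt]
    rw [Module.finrank_fintype_fun_eq_card, Module.finrank_pi_fintype]
    simpa [hfin] using hnn
  have hbig : 2 * γ₀ ^ n' < ((S.image φ).card : ℝ) := by
    rw [card_image_of_injective S hφ]
    have h1 : γ₀ ^ n' ≤ g * γ ^ n := by
      calc γ₀ ^ n' ≤ g ^ n' := pow_le_pow_left₀ hγ₀.le (le_max_left _ _) _
        _ = g * γ ^ ((s + 1) * (n / (s + 1))) := by rw [hn', pow_succ', pow_mul, hγ]
        _ ≤ g * γ ^ n := by
          gcongr
          exact Nat.mul_div_le n (s + 1)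
    have h2 : 0 < γ ^ n := by positivity
    nlinarith
  obtain ⟨y, z, hyz, u, hu, hdiff⟩ := hmain v hv n' (S.image φ) hbig
  choose y' hy'S hy' using fun r => mem_image.1 (hyz r).1
  choose z' hz'S hz' using fun r => mem_image.1 (hyz r).2
  refine ⟨y', z', fun r => ⟨hy'S r, hz'S r, ?_⟩, fun i => hφ ?_⟩
  · intro heq
    have := hdiff r
    rw [← hy', ← hz', heq, sub_self, eq_comm, smul_eq_zero] at this
    exact this.elim (hv r) hu
  · rw [map_sum, map_zero]
    simp only [map_smul, map_sub, hy', hz', hdiff]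
    simp only [← smul_assoc]
    rw [← sum_smul, hvker, zero_smul]

/-! ### Sets whose combinations have many representations -/

open Finset in
/-- A sparse relation on a finite set has a large independent set. -/
theorem exists_independent_of_sparse {V : Type*} [DecidableEq V] (S : Finset V) (R : V → V → Prop)
    [DecidableRel R] (d : ℝ) (hd : 0 < d)
    (hR : 2 * (((S ×ˢ S).filter fun p => p.1 ≠ p.2 ∧ R p.1 p.2).card : ℝ) ≤ d * S.card) :
    ∃ I ⊆ S, (∀ x ∈ I, ∀ y ∈ I, x ≠ y → ¬ R x y) ∧ (S.card : ℝ) ≤ 2 * (1 + 2 * d) * I.card := by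
  set E := ((S ×ˢ S).filter fun p => p.1 ≠ p.2 ∧ R p.1 p.2).card with hE
  let out : V → Finset V := fun x => S.filter fun y => x ≠ y ∧ R x y
  let inn : V → Finset V := fun x => S.filter fun y => y ≠ x ∧ R y x
  let N : V → Finset V := fun x => out x ∪ inn x
  have hout : ∑ x ∈ S, (out x).card = E := by
    rw [hE, card_filter, sum_product]
    exact sum_congr rfl fun x _ => card_filter _ _
  have hinn : ∑ x ∈ S, (inn x).card = E := by
    rw [hE, card_filter, sum_product_right]
    exact sum_congr rfl fun x _ => card_filter _ _
  have hN : (∑ x ∈ S, ((N x).card : ℝ)) ≤ 2 * E := by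
    have h1 : ∑ x ∈ S, (N x).card ≤ E + E := by
      calc ∑ x ∈ S, (N x).card ≤ ∑ x ∈ S, ((out x).card + (inn x).card) :=
            sum_le_sum fun x _ => card_union_le _ _
        _ = E + E := by rw [sum_add_distrib, hout, hinn]
    have h2 : ((∑ x ∈ S, (N x).card : ℕ) : ℝ) ≤ ((E + E : ℕ) : ℝ) := by exact_mod_cast h1
    push_cast at h2
    linarith
  -- By Markov's inequality at least half of the vertices have degree at most 2d. A maximal
  -- independent set among these covers them with its neighbourhoods.
  let L := S.filter fun x => ((N x).card : ℝ) ≤ 2 * d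
  have hL : (S.card : ℝ) ≤ 2 * L.card := by
    have h1 : ((S.filter fun x => ¬ ((N x).card : ℝ) ≤ 2 * d).card : ℝ) * (2 * d) ≤ 2 * E := by
      rw [← nsmul_eq_mul]
      refine (card_nsmul_le_sum _ (fun x => ((N x).card : ℝ)) _ fun x hx => ?_).trans
        ((sum_le_sum_of_subset_of_nonneg (filter_subset _ _) fun _ _ _ => by positivity).trans hN)
      exact (not_le.1 (mem_filter.1 hx).2).le
    have h2 : (L.card : ℝ) + (S.filter fun x => ¬ ((N x).card : ℝ) ≤ 2 * d).card = S.card := by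
      exact_mod_cast card_filter_add_card_filter_not _
    have h3 : (S.filter fun x => ¬ ((N x).card : ℝ) ≤ 2 * d).card * 2 ≤ (S.card : ℝ) := by
      refine le_of_mul_le_mul_right ?_ hd
      linarith
    linarith
  obtain ⟨I, hI, hmax⟩ := exists_max_image
    (L.powerset.filter fun I => ∀ x ∈ I, ∀ y ∈ I, x ≠ y → ¬ R x y) card ⟨∅, by simp⟩
  obtain ⟨hIL, hind⟩ := mem_filter.1 hI
  rw [mem_powerset] at hIL
  have hcov : L ⊆ I ∪ I.biUnion N := by
    intro x hx
    by_contra hx'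
    rw [mem_union, mem_biUnion] at hx'
    push Not at hx'
    obtain ⟨hxI, hxN⟩ := hx'
    have hxS := (mem_filter.1 hx).1
    have hnb : ∀ y ∈ I, ¬ R x y ∧ ¬ R y x := by
      intro y hy
      have hne : x ≠ y := fun h => hxI (h ▸ hy)
      have := hxN y hy
      simp only [N, out, inn, mem_union, mem_filter, not_or, not_and] at this
      exact ⟨this.2 hxS hne, this.1 hxS hne.symm⟩
    have h1 := hmax (insert x I) (by
      refine mem_filter.2 ⟨mem_powerset.2 (insert_subset hx hIL), ?_⟩
      intro a ha c hc hac
      rw [mem_insert] at ha hc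
      rcases ha with rfl | ha <;> rcases hc with rfl | hc
      · exact absurd rfl hac
      · exact (hnb c hc).1
      · exact (hnb a ha).2
      · exact hind a ha c hc hac)
    rw [card_insert_of_notMem hxI] at h1
    omega
  refine ⟨I, hIL.trans (filter_subset _ _), hind, ?_⟩
  have h1 : (L.card : ℝ) ≤ I.card + ∑ x ∈ I, ((N x).card : ℝ) := by
    have := (card_le_card hcov).trans ((card_union_le _ _).trans
      (Nat.add_le_add_left card_biUnion_le _))
    exact_mod_cast this
  have h2 : ∑ x ∈ I, ((N x).card : ℝ) ≤ I.card * (2 * d) := by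
    rw [← nsmul_eq_mul]
    exact sum_le_card_nsmul _ _ _ fun x hx => (mem_filter.1 (hIL hx)).2
  linarith

/-- Every combination of two elements of `T` with nonzero coefficients, other than a zero
combination `c • x - c • x`, is attained by pairs of distinct elements of `S` avoiding any given
set of at most `M` elements. -/
def PairRich (F : Type*) [Field F] {V : Type*} [AddCommGroup V] [Module F V] (M : ℕ)
    (S T : Finset V) : Prop :=
  T ⊆ S ∧ ∀ c d : F, c ≠ 0 → d ≠ 0 → ∀ x ∈ T, ∀ y ∈ T, (x ≠ y ∨ c + d ≠ 0) →
    ∀ Z : Finset V, Z.card ≤ M →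
      ∃ x' ∈ S, ∃ y' ∈ S, x' ∉ Z ∧ y' ∉ Z ∧ x' ≠ y' ∧ c • x' + d • y' = c • x + d • y

open Classical in
/-- The pairs of distinct elements of `S` on which the form `c • x + d • y` takes the value `w`. -/
noncomputable def pairReps {F : Type*} [Field F] {V : Type*} [AddCommGroup V] [Module F V]
    (S : Finset V) (c d : F) (w : V) : Finset (V × V) :=
  (S ×ˢ S).filter fun p => p.1 ≠ p.2 ∧ c • p.1 + d • p.2 = w

theorem mem_pairReps {F : Type*} [Field F] {V : Type*} [AddCommGroup V] [Module F V]
    {S : Finset V} {c d : F} {w : V} {p : V × V} :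
    p ∈ pairReps S c d w ↔
      (p.1 ∈ S ∧ p.2 ∈ S) ∧ p.1 ≠ p.2 ∧ c • p.1 + d • p.2 = w := by
  simp [pairReps]

-- Either entry of a representation determines the other because `c` and `d` are nonzero, so each
-- element of Z spoils at most two representations.
open Finset in
theorem exists_pair_of_lt_card_pairReps {F : Type*} [Field F] {V : Type*} [AddCommGroup V]
    [Module F V] {S : Finset V} {c d : F} (hc : c ≠ 0) (hd : d ≠ 0) {w : V} {M : ℕ}
    (h : 2 * M < (pairReps S c d w).card) (Z : Finset V) (hZ : Z.card ≤ M) :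
    ∃ x ∈ S, ∃ y ∈ S, x ∉ Z ∧ y ∉ Z ∧ x ≠ y ∧ c • x + d • y = w := by
  classical
  by_contra hcon
  push Not at hcon
  have hsub : pairReps S c d w ⊆ (pairReps S c d w).filter (fun p => p.1 ∈ Z) ∪
      (pairReps S c d w).filter (fun p => p.2 ∈ Z) := by
    intro p hp
    rw [mem_union, mem_filter, mem_filter]
    obtain ⟨⟨h1, h2⟩, hne, hw⟩ := mem_pairReps.1 hp
    by_contra hno
    push Not at hno
    exact hcon p.1 h1 p.2 h2 (hno.1 hp) (hno.2 hp) hne hw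
  have h1 : ((pairReps S c d w).filter (fun p => p.1 ∈ Z)).card ≤ Z.card := by
    refine card_le_card_of_injOn Prod.fst (fun p hp => (mem_filter.1 hp).2) ?_
    intro p hp p' hp' heq
    have e1 := (mem_pairReps.1 (mem_filter.1 hp).1).2.2
    have e2 := (mem_pairReps.1 (mem_filter.1 hp').1).2.2
    have heq : p.1 = p'.1 := heq
    rw [← e2, heq] at e1
    exact Prod.ext heq (smul_right_injective V hd (add_left_cancel e1))
  have h2 : ((pairReps S c d w).filter (fun p => p.2 ∈ Z)).card ≤ Z.card := by
    refine card_le_card_of_injOn Prod.snd (fun p hp => (mem_filter.1 hp).2) ?_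
    intro p hp p' hp' heq
    have e1 := (mem_pairReps.1 (mem_filter.1 hp).1).2.2
    have e2 := (mem_pairReps.1 (mem_filter.1 hp').1).2.2
    have heq : p.2 = p'.2 := heq
    rw [← e2, heq] at e1
    exact Prod.ext (smul_right_injective V hc (add_right_cancel e1)) heq
  have h3 := (card_le_card hsub).trans (card_union_le _ _)
  omega

open Finset in
/-- Only few elements have a multiple `(c + d) • x` with few representations `c • y + d • z`. -/
theorem exists_card_poor_le (F : Type*) [Field F] [Fintype F] :
    ∃ γ : ℝ, 0 < γ ∧ γ < Fintype.card F ∧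
      ∀ c d : F, c ≠ 0 → d ≠ 0 → c + d ≠ 0 → ∀ (M n : ℕ) (S : Finset (Fin n → F)),
        ((S.filter fun x => (pairReps S c d ((c + d) • x)).card ≤ 2 * M).card : ℝ) ≤
          6 * (16 * M + 3) * γ ^ n := by
  classical
  obtain ⟨γ, hγ0, hγ, hmean⟩ := exists_weighted_mean F
  refine ⟨γ, hγ0, hγ, fun c d hc hd hcd M n S => ?_⟩
  set U := S.filter fun x => (pairReps S c d ((c + d) • x)).card ≤ 2 * M with hU
  -- Poor elements have out-degree at most 4M. In an R-independent set a weighted mean z of x ≠ y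
  -- would be related to x or y, and at least one of these differs from z.
  let R : (Fin n → F) → (Fin n → F) → Prop := fun x y =>
    ∃ p ∈ pairReps S c d ((c + d) • x), y = p.1 ∨ y = p.2
  have hR : ((U ×ˢ U).filter fun p => p.1 ≠ p.2 ∧ R p.1 p.2).card ≤ U.card * (4 * M) := by
    have hsub : ((U ×ˢ U).filter fun p => p.1 ≠ p.2 ∧ R p.1 p.2) ⊆
        U.biUnion fun x => ((pairReps S c d ((c + d) • x)).image Prod.fst ∪
          (pairReps S c d ((c + d) • x)).image Prod.snd).image (Prod.mk x) := by
      rintro ⟨x, y⟩ hp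
      obtain ⟨hxy, -, p, hpr, hyp⟩ := mem_filter.1 hp
      refine mem_biUnion.2 ⟨x, (mem_product.1 hxy).1, mem_image_of_mem _ ?_⟩
      rcases hyp with h | h
      · exact mem_union_left _ (mem_image.2 ⟨p, hpr, h.symm⟩)
      · exact mem_union_right _ (mem_image.2 ⟨p, hpr, h.symm⟩)
    refine (card_le_card hsub).trans (card_biUnion_le_card_mul _ _ _ fun x hx => ?_)
    refine card_image_le.trans ((card_union_le _ _).trans ?_)
    have h1 := (mem_filter.1 hx).2
    have h2 := card_image_le (s := pairReps S c d ((c + d) • x)) (f := Prod.fst)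
    have h3 := card_image_le (s := pairReps S c d ((c + d) • x)) (f := Prod.snd)
    omega
  obtain ⟨I, hIU, hind, hcard⟩ := exists_independent_of_sparse U R (8 * M + 1) (by positivity) (by
    have : (((U ×ˢ U).filter fun p => p.1 ≠ p.2 ∧ R p.1 p.2).card : ℝ) ≤ U.card * (4 * M) := by
      exact_mod_cast hR
    nlinarith [Nat.cast_nonneg (α := ℝ) U.card])
  have hI : (I.card : ℝ) ≤ 3 * γ ^ n := by
    by_contra hlt
    push Not at hlt
    obtain ⟨x, hx, y, hy, z, hz, hxy, heq⟩ := hmean c d hc hd hcd n I hlt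
    have hmem : (x, y) ∈ pairReps S c d ((c + d) • z) :=
      mem_pairReps.2 ⟨⟨(mem_filter.1 (hIU hx)).1, (mem_filter.1 (hIU hy)).1⟩, hxy, heq⟩
    by_cases hzx : z = x
    · exact hind z hz y hy (hzx ▸ hxy) ⟨_, hmem, Or.inr rfl⟩
    · exact hind z hz x hx hzx ⟨_, hmem, Or.inl rfl⟩
  calc (U.card : ℝ) ≤ 2 * (1 + 2 * (8 * M + 1)) * I.card := hcard
    _ ≤ 2 * (1 + 2 * (8 * M + 1)) * (3 * γ ^ n) := by gcongr
    _ = 6 * (16 * M + 3) * γ ^ n := by ring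

open Finset in
/-- The number of pairs on which some form takes a value with few representations is small. -/
theorem card_poor_pairs_le {F : Type*} [Field F] [Fintype F] (M n : ℕ)
    (S T : Finset (Fin n → F)) (hTS : T ⊆ S) [DecidableEq (Fin n → F)]
    [DecidableRel fun x y : Fin n → F =>
      ∃ c d : F, (pairReps S c d (c • x + d • y)).card ≤ 2 * M] :
    ((T ×ˢ T).filter fun p => p.1 ≠ p.2 ∧
      ∃ c d : F, (pairReps S c d (c • p.1 + d • p.2)).card ≤ 2 * M).card ≤
      Fintype.card F ^ 2 * Fintype.card F ^ n * (2 * M) := by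
  classical
  have hsub : ((T ×ˢ T).filter fun p => p.1 ≠ p.2 ∧
      ∃ c d : F, (pairReps S c d (c • p.1 + d • p.2)).card ≤ 2 * M) ⊆
      -- Each poor pair is charged to its coefficients and value; such a triple receives at most 2M
      -- pairs.
      (univ : Finset ((F × F) × (Fin n → F))).biUnion fun t =>
        if (pairReps S t.1.1 t.1.2 t.2).card ≤ 2 * M then pairReps S t.1.1 t.1.2 t.2 else ∅ := by
    rintro ⟨x, y⟩ hp
    obtain ⟨hxy, hne, c, d, hcd⟩ := mem_filter.1 hp
    rw [mem_product] at hxy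
    refine mem_biUnion.2 ⟨((c, d), c • x + d • y), mem_univ _, ?_⟩
    rw [if_pos hcd]
    exact mem_pairReps.2 ⟨⟨hTS hxy.1, hTS hxy.2⟩, hne, rfl⟩
  refine (card_le_card hsub).trans ((card_biUnion_le_card_mul _ _ (2 * M) fun t _ => ?_).trans ?_)
  · split_ifs with h
    · exact h
    · simp
  · rw [card_univ, Fintype.card_prod, Fintype.card_prod, Fintype.card_pi]
    simp [sq]

open Finset in
/-- Every large set `S` has a large subset `T` such that `PairRich F M S T`. -/
theorem exists_pairRich_subset (F : Type*) [Field F] [Fintype F] (M : ℕ) (β₁ γ₁ : ℝ)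
    (hβ₁ : 0 < β₁) (hγ₁ : 0 < γ₁) (hγ₁q : γ₁ < Fintype.card F) :
    ∃ β γ : ℝ, 0 < β ∧ 0 < γ ∧ γ < Fintype.card F ∧
      ∀ (n : ℕ) (S : Finset (Fin n → F)), β * γ ^ n ≤ S.card →
        ∃ T : Finset (Fin n → F), PairRich F M S T ∧ β₁ * γ₁ ^ n ≤ T.card := by
  classical
  obtain ⟨γ₃, hγ₃, hγ₃q, hpoor⟩ := exists_card_poor_le F
  set q : ℝ := (Fintype.card F : ℝ) with hq
  have hq1 : 1 < q := by rw [hq]; exact_mod_cast Fintype.one_lt_card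
  set g := max γ₁ γ₃ with hg
  have hg0 : 0 < g := hγ₁.trans_le (le_max_left _ _)
  have hgq : g < q := max_lt hγ₁q hγ₃q
  -- The independent set has size of order |S₀|² / q^n, so γ² = q g is what leaves a set of order
  -- g^n.
  set γ := Real.sqrt (q * g) with hγ
  have hγsq : γ ^ 2 = q * g := Real.sq_sqrt (by positivity)
  have hγ0 : 0 < γ := Real.sqrt_pos.2 (by positivity)
  have hgγ : g ≤ γ := by
    refine le_of_lt (lt_of_pow_lt_pow_left₀ 2 hγ0.le ?_)
    rw [hγsq]; nlinarith
  have hγq : γ < q := by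
    refine lt_of_pow_lt_pow_left₀ 2 (by positivity) ?_
    rw [hγsq]; nlinarith
  set K₃ : ℝ := q ^ 2 * (6 * (16 * M + 3)) with hK₃
  set K₄ : ℝ := 2 * (1 + 2 * ((4 * M + 1) * q ^ 2)) with hK₄
  have hK₃0 : 0 < K₃ := by positivity
  have hK₄0 : 0 < K₄ := by positivity
  refine ⟨2 * K₃ + 4 * K₄ * β₁ + 1, γ, by positivity, hγ0, hγq, fun n S hS => ?_⟩
  set β := 2 * K₃ + 4 * K₄ * β₁ + 1 with hβ
  have hβ0 : 0 < β := by positivity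
  have hSpos : (0 : ℝ) < S.card := lt_of_lt_of_le (by positivity) hS
  -- Equal pairs x = y are handled by deleting poor elements; unequal pairs by the independent set
  -- below.
  let U : Finset (Fin n → F) := (univ : Finset (F × F)).biUnion fun t =>
    if t.1 ≠ 0 ∧ t.2 ≠ 0 ∧ t.1 + t.2 ≠ 0 then
      S.filter fun x => (pairReps S t.1 t.2 ((t.1 + t.2) • x)).card ≤ 2 * M else ∅
  have hU : (U.card : ℝ) ≤ K₃ * γ ^ n := by
    have h1 : (U.card : ℝ) ≤ ∑ t : F × F, 6 * (16 * M + 3) * g ^ n := by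
      have : (U.card : ℝ) ≤ ∑ t : F × F, (((if t.1 ≠ 0 ∧ t.2 ≠ 0 ∧ t.1 + t.2 ≠ 0 then
          S.filter fun x => (pairReps S t.1 t.2 ((t.1 + t.2) • x)).card ≤ 2 * M
          else ∅ : Finset (Fin n → F)).card : ℕ) : ℝ) := by
        exact_mod_cast card_biUnion_le
      refine this.trans (sum_le_sum fun t _ => ?_)
      split_ifs with h
      · refine (hpoor t.1 t.2 h.1 h.2.1 h.2.2 M n S).trans ?_
        gcongr
        exact le_max_right _ _
      · simp only [card_empty, Nat.cast_zero]
        positivity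
    rw [sum_const, card_univ, Fintype.card_prod, nsmul_eq_mul] at h1
    push_cast at h1
    rw [← hq] at h1
    calc (U.card : ℝ) ≤ q * q * (6 * (16 * M + 3) * g ^ n) := h1
      _ = K₃ * g ^ n := by rw [hK₃]; ring
      _ ≤ K₃ * γ ^ n := by gcongr
  set S₀ := S \ U with hS₀
  have hS₀half : (S.card : ℝ) ≤ 2 * S₀.card := by
    have h1 : (S.card : ℝ) - U.card ≤ S₀.card := by
      have := le_card_sdiff U S
      rw [← hS₀] at this
      have h2 : S.card ≤ S₀.card + U.card := by omega
      have h3 : (S.card : ℝ) ≤ S₀.card + U.card := by exact_mod_cast h2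
      linarith
    have h2 : 2 * K₃ * γ ^ n ≤ S.card := by
      refine le_trans ?_ hS
      gcongr
      rw [hβ]
      have : 0 < 4 * K₄ * β₁ := by positivity
      linarith
    linarith
  have hS₀pos : (0 : ℝ) < S₀.card := by linarith
  have hS₀q : (S₀.card : ℝ) ≤ q ^ n := by
    have : S₀.card ≤ Fintype.card F ^ n := by
      simpa using card_le_univ S₀
    rw [hq]
    exact_mod_cast this
  let R : (Fin n → F) → (Fin n → F) → Prop := fun x y =>
    ∃ c d : F, (pairReps S c d (c • x + d • y)).card ≤ 2 * M
  have hE := card_poor_pairs_le M n S S₀ sdiff_subset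
  have hE' : (((S₀ ×ˢ S₀).filter fun p => p.1 ≠ p.2 ∧ R p.1 p.2).card : ℝ) ≤
      q ^ 2 * q ^ n * (2 * M) := by
    rw [hq]; exact_mod_cast hE
  have hqn : 0 < q ^ n := by positivity
  obtain ⟨I, hIS, hind, hcard⟩ := exists_independent_of_sparse S₀ R
    ((4 * M + 1) * q ^ 2 * q ^ n / S₀.card) (by positivity) (by
      rw [div_mul_cancel₀ _ hS₀pos.ne']
      have : 0 < q ^ 2 * q ^ n := by positivity
      linarith)
  refine ⟨I, ⟨hIS.trans sdiff_subset, ?_⟩, ?_⟩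
  · intro c d hc hd x hx y hy hxy Z hZ
    refine exists_pair_of_lt_card_pairReps hc hd ?_ Z hZ
    by_cases hne : x = y
    · subst hne
      have hcd : c + d ≠ 0 := hxy.resolve_left (by simp)
      obtain ⟨hxS, hxU⟩ := mem_sdiff.1 (hIS hx)
      by_contra hle
      refine hxU (mem_biUnion.2 ⟨(c, d), mem_univ _, ?_⟩)
      rw [if_pos ⟨hc, hd, hcd⟩]
      refine mem_filter.2 ⟨hxS, ?_⟩
      rw [add_smul]
      exact not_lt.1 hle
    · by_contra hle
      exact hind x hx y hy hne ⟨c, d, not_lt.1 hle⟩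
  · have h1 : (S₀.card : ℝ) * S₀.card ≤ K₄ * q ^ n * I.card := by
      calc (S₀.card : ℝ) * S₀.card
          ≤ 2 * (1 + 2 * ((4 * M + 1) * q ^ 2 * q ^ n / S₀.card)) * I.card * S₀.card := by gcongr
        _ = 2 * (S₀.card + 2 * ((4 * M + 1) * q ^ 2 * q ^ n)) * I.card := by
            field_simp
        _ ≤ 2 * (q ^ n + 2 * ((4 * M + 1) * q ^ 2 * q ^ n)) * I.card := by gcongr
        _ = K₄ * q ^ n * I.card := by rw [hK₄]; ring
    have h2 : β * γ ^ n / 2 ≤ S₀.card := by linarith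
    have h3 : (β * γ ^ n / 2) * (β * γ ^ n / 2) ≤ K₄ * q ^ n * I.card :=
      (mul_self_le_mul_self (by positivity) h2).trans h1
    have h4 : (β * γ ^ n / 2) * (β * γ ^ n / 2) = β ^ 2 / 4 * g ^ n * q ^ n := by
      have : γ ^ n * γ ^ n = q ^ n * g ^ n := by
        rw [← mul_pow, ← mul_pow, ← hγsq, sq]
      linear_combination (β ^ 2 / 4) * this
    rw [h4] at h3
    have h5 : β ^ 2 / 4 * g ^ n ≤ K₄ * I.card := by
      exact le_of_mul_le_mul_right (h3.trans_eq (by ring)) hqn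
    have h6 : 4 * K₄ * β₁ ≤ β ^ 2 := by
      have : 0 < K₄ * β₁ := by positivity
      have h7 : 4 * K₄ * β₁ ≤ β := by rw [hβ]; linarith only [hK₃0]
      have h8 : 1 ≤ β := by rw [hβ]; linarith only [this, hK₃0]
      nlinarith only [h7, h8]
    have h9 : γ₁ ^ n ≤ g ^ n := pow_le_pow_left₀ hγ₁.le (le_max_left _ _) n
    have h10 : 0 < γ₁ ^ n := by positivity
    refine le_of_mul_le_mul_left ?_ hK₄0
    calc K₄ * (β₁ * γ₁ ^ n) = 4 * K₄ * β₁ / 4 * γ₁ ^ n := by ring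
      _ ≤ β ^ 2 / 4 * g ^ n := by gcongr
      _ ≤ K₄ * I.card := h5

/-- Iterated version of `exists_pairRich_subset`. -/
theorem exists_pairRich_chain (F : Type*) [Field F] [Fintype F] (M t : ℕ) (β₁ γ₁ : ℝ)
    (hβ₁ : 0 < β₁) (hγ₁ : 0 < γ₁) (hγ₁q : γ₁ < Fintype.card F) :
    ∃ β γ : ℝ, 0 < β ∧ 0 < γ ∧ γ < Fintype.card F ∧
      ∀ (n : ℕ) (S : Finset (Fin n → F)), β * γ ^ n ≤ S.card →
        ∃ T : ℕ → Finset (Fin n → F), T 0 = S ∧ (∀ i < t, PairRich F M (T i) (T (i + 1))) ∧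
          β₁ * γ₁ ^ n ≤ (T t).card := by
  induction t with
  | zero => exact ⟨β₁, γ₁, hβ₁, hγ₁, hγ₁q, fun n S hS => ⟨fun _ => S, rfl, by simp, hS⟩⟩
  | succ t ih =>
    obtain ⟨β, γ, hβ, hγ, hγq, h⟩ := ih
    obtain ⟨β', γ', hβ', hγ', hγq', h'⟩ := exists_pairRich_subset F M β γ hβ hγ hγq
    refine ⟨β', γ', hβ', hγ', hγq', fun n S hS => ?_⟩
    obtain ⟨S', hrich, hS'⟩ := h' n S hS
    obtain ⟨T, hT0, hT, hcard⟩ := h n S' hS'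
    refine ⟨fun i => Nat.casesOn i S T, rfl, ?_, hcard⟩
    rintro (_ | i) hi
    · simpa [hT0] using hrich
    · exact hT i (by omega)

theorem PairRich.chain_subset {F : Type*} [Field F] {V : Type*} [AddCommGroup V] [Module F V]
    {M t : ℕ} {T : ℕ → Finset V} (hT : ∀ i < t, PairRich F M (T i) (T (i + 1))) {i j : ℕ}
    (hij : i ≤ j) (hjt : j ≤ t) : T j ⊆ T i := by
  induction j, hij using Nat.le_induction with
  | base => exact Finset.Subset.refl _
  | succ j hij ih => exact (hT j (by omega)).1.trans (ih (by omega))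

/-! ### Making the entries distinct -/

open Finset in
/-- A linear combination of elements that are not all equal can be rewritten with distinct
elements, avoiding a given set, by replacing one pair after the other. -/
theorem exists_injOn_insert_of_ne {F : Type*} [Field F] {V : Type*} [AddCommGroup V] [Module F V]
    [DecidableEq V] {ι : Type*} [DecidableEq ι] {M : ℕ} (T : ℕ → Finset V) (c : ι → F)
    (hc : ∀ j, c j ≠ 0) (t : ℕ) (hT : ∀ i < t, PairRich F M (T i) (T (i + 1)))
    (C : Finset ι) (hC : C.card = t) (a : ι) (ha : a ∉ C) (x : ι → V)
    (hx : ∀ j ∈ insert a C, x j ∈ T t) (b : ι) (hb : b ∈ C) (hab : x a ≠ x b) (Z : Finset V)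
    (hZ : Z.card + t + 1 ≤ M) :
    ∃ x' : ι → V, (∀ j ∈ insert a C, x' j ∈ T 0 ∧ x' j ∉ Z) ∧ Set.InjOn x' (insert a C : Finset ι) ∧
      ∑ j ∈ insert a C, c j • x' j = ∑ j ∈ insert a C, c j • x j := by
  induction t generalizing C a x b Z with
  | zero =>
    rw [card_eq_zero] at hC
    simp [hC] at hb
  | succ t ih =>
    have hD : (C.erase b).card = t := by rw [card_erase_of_mem hb, hC, Nat.add_sub_cancel]
    obtain ⟨D, hbD, rfl⟩ : ∃ D, b ∉ D ∧ C = insert b D :=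
      ⟨C.erase b, notMem_erase b C, (insert_erase hb).symm⟩
    rw [erase_insert hbD] at hD
    -- Avoiding the entries on `D` makes `b'` differ from the next entry, so the pair at `b` and an
    -- element of `D` can be exchanged next; `a'` is final and joins the avoided set.
    obtain ⟨a', ha', b', hb', haZ, hbZ, hab', hsum⟩ := (hT t (by omega)).2 (c a) (c b) (hc a) (hc b)
      (x a) (hx a (mem_insert_self _ _)) (x b) (hx b (by simp)) (Or.inl hab) (Z ∪ D.image x) (by
        have h1 := card_union_le Z (D.image x)
        have h2 := card_image_le (s := D) (f := x)
        omega)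
    rw [mem_union, not_or] at haZ hbZ
    have hsub := fun i (hi : i ≤ t + 1) => PairRich.chain_subset hT hi le_rfl
    have hsub' : T t ⊆ T 0 := PairRich.chain_subset hT (Nat.zero_le t) (by omega)
    obtain ⟨x'', hx'', hinj, hsum''⟩ : ∃ x'' : ι → V,
        (∀ j ∈ insert b D, x'' j ∈ T 0 ∧ x'' j ∉ insert a' Z) ∧
        Set.InjOn x'' (insert b D : Finset ι) ∧
        ∑ j ∈ insert b D, c j • x'' j = c b • b' + ∑ j ∈ D, c j • x j := by
      rcases D.eq_empty_or_nonempty with rfl | ⟨e, he⟩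
      · refine ⟨fun _ => b', ?_, by simp, by simp⟩
        intro j _
        exact ⟨hsub' hb', by simp [hab'.symm, hbZ.1]⟩
      · have hupd : ∀ j ∈ D, Function.update x b b' j = x j := fun j hj =>
          Function.update_of_ne (ne_of_mem_of_not_mem hj hbD) _ _
        obtain ⟨x'', h1, h2, h3⟩ := ih (fun i hi => hT i (by omega)) D hD b hbD
          (Function.update x b b') (by
            intro j hj
            rcases mem_insert.1 hj with rfl | hj
            · simpa using hb'
            · rw [hupd j hj]
              exact hsub t (by omega) (hx j (by simp [hj])))
          e he (by
            rw [hupd e he, Function.update_self]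
            exact fun h => hbZ.2 (h ▸ mem_image_of_mem x he))
          (insert a' Z) (by
            have := card_insert_le a' Z
            omega)
        refine ⟨x'', h1, h2, h3.trans ?_⟩
        rw [sum_insert hbD, Function.update_self]
        exact congrArg _ (sum_congr rfl fun j hj => by rw [hupd j hj])
    have hupd : ∀ j ∈ insert b D, Function.update x'' a a' j = x'' j := fun j hj =>
      Function.update_of_ne (ne_of_mem_of_not_mem hj ha) _ _
    refine ⟨Function.update x'' a a', ?_, ?_, ?_⟩
    · intro j hj
      rcases mem_insert.1 hj with rfl | hj
      · rw [Function.update_self]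
        exact ⟨hsub' ha', haZ.1⟩
      · rw [hupd j hj]
        exact ⟨(hx'' j hj).1, fun h => (hx'' j hj).2 (mem_insert_of_mem h)⟩
    · rw [coe_insert, Set.injOn_insert (by simpa using ha)]
      refine ⟨fun i hi j hj hij => ?_, ?_⟩
      · rw [hupd i hi, hupd j hj] at hij
        exact hinj hi hj hij
      · rintro ⟨j, hj, hja⟩
        rw [hupd j hj, Function.update_self] at hja
        exact (hx'' j hj).2 (hja ▸ mem_insert_self _ _)
    · rw [sum_insert ha, sum_insert ha, Function.update_self, sum_insert hbD (f := fun j => c j • x j),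
        sum_congr rfl fun j hj => by rw [hupd j hj], hsum'', ← add_assoc, hsum, add_assoc]

open Finset in
/-- A linear combination with at least two terms can be rewritten with distinct elements avoiding
a given set, unless it is of the form `c • x - c • x`. -/
theorem exists_injOn_of_two_le_card {F : Type*} [Field F] {V : Type*} [AddCommGroup V] [Module F V]
    [DecidableEq V] {ι : Type*} [DecidableEq ι] {M : ℕ} (T : ℕ → Finset V) (c : ι → F)
    (hc : ∀ j, c j ≠ 0) (C : Finset ι)
    (hT : ∀ i < C.card, PairRich F M (T i) (T (i + 1))) (hcard : 2 ≤ C.card)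
    (hnontriv : 2 ≤ (T C.card).card) (x : ι → V) (hx : ∀ j ∈ C, x j ∈ T C.card)
    (hpair : C.card = 2 → ∑ j ∈ C, c j = 0 → ∀ a ∈ C, ∀ b ∈ C, a ≠ b → x a ≠ x b)
    (Z : Finset V) (hZ : Z.card + C.card ≤ M) :
    ∃ x' : ι → V, (∀ j ∈ C, x' j ∈ T 0 ∧ x' j ∉ Z) ∧ Set.InjOn x' C ∧
      ∑ j ∈ C, c j • x' j = ∑ j ∈ C, c j • x j := by
  have hlevel : T C.card ⊆ T (C.card - 1) := PairRich.chain_subset hT (by omega) le_rfl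
  have key : ∀ x : ι → V, (∀ j ∈ C, x j ∈ T (C.card - 1)) → ∀ a ∈ C, ∀ b ∈ C, x a ≠ x b →
      ∃ x' : ι → V, (∀ j ∈ C, x' j ∈ T 0 ∧ x' j ∉ Z) ∧ Set.InjOn x' C ∧
        ∑ j ∈ C, c j • x' j = ∑ j ∈ C, c j • x j := by
    intro x hx a ha b hb hab
    have hins := insert_erase ha
    have h := exists_injOn_insert_of_ne T c hc (C.card - 1) (fun i hi => hT i (by omega))
      (C.erase a) (card_erase_of_mem ha) a (notMem_erase a C) x (by rwa [hins]) b
      (mem_erase.2 ⟨fun h => hab (h ▸ rfl), hb⟩) hab Z (by omega)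
    rwa [hins] at h
  by_cases hdist : ∃ a ∈ C, ∃ b ∈ C, x a ≠ x b
  · obtain ⟨a, ha, b, hb, hab⟩ := hdist
    exact key x (fun j hj => hlevel (hx j hj)) a ha b hb hab
  push Not at hdist
  have hsplit : ∀ a ∈ C, ∀ b ∈ C, a ≠ b → ∀ a' b' : V, c a • a' + c b • b' = c a • x a + c b • x b →
      ∑ j ∈ C, c j • Function.update (Function.update x a a') b b' j = ∑ j ∈ C, c j • x j := by
    intro a ha b hb hab a' b' h
    have hb' : b ∈ C.erase a := mem_erase.2 ⟨hab.symm, hb⟩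
    rw [← add_sum_erase _ _ ha, ← add_sum_erase _ _ hb', ← add_sum_erase _ _ ha,
      ← add_sum_erase _ _ hb', ← add_assoc, ← add_assoc]
    rw [Function.update_self, Function.update_of_ne hab, Function.update_self, h]
    refine congrArg _ (sum_congr rfl fun j hj => ?_)
    have h1 := mem_erase.1 hj
    have h2 := mem_erase.1 h1.2
    rw [Function.update_of_ne h1.1, Function.update_of_ne h2.1]
  -- All entries are equal here. The top level of the chain is reserved for separating two of them.
  by_cases hsum : ∃ a ∈ C, ∃ b ∈ C, a ≠ b ∧ c a + c b ≠ 0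
  · obtain ⟨a, ha, b, hb, hab, hne⟩ := hsum
    have hrich := hT (C.card - 1) (by omega)
    rw [Nat.sub_add_cancel (by omega)] at hrich
    obtain ⟨a', ha', b', hb', -, -, hab', heq⟩ := hrich.2 (c a) (c b) (hc a) (hc b) (x a) (hx a ha)
      (x b) (hx b hb) (Or.inr hne) ∅ (by simp)
    obtain ⟨x', h1, h2, h3⟩ := key (Function.update (Function.update x a a') b b') (by
        intro j hj
        by_cases hjb : j = b
        · subst hjb; simpa using hb'
        · rw [Function.update_of_ne hjb]
          by_cases hja : j = a
          · subst hja; simpa using ha'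
          · rw [Function.update_of_ne hja]
            exact hlevel (hx j hj)) a ha b hb (by simpa [hab] using hab')
    exact ⟨x', h1, h2, h3.trans (hsplit a ha b hb hab a' b' heq)⟩
  · push Not at hsum
    obtain ⟨a, ha, b, hb, hab⟩ := one_lt_card.1 hcard
    have h3 : 2 < C.card := by
      refine lt_of_le_of_ne hcard fun h2 => ?_
      have hCab : C = {a, b} := by
        refine (eq_of_subset_of_card_le ?_ ?_).symm
        · simp [insert_subset_iff, ha, hb]
        · rw [card_pair hab, h2]
      refine hpair h2.symm ?_ a ha b hb hab (hdist a ha b hb)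
      rw [hCab, sum_pair hab]
      exact hsum a ha b hb hab
    -- The coefficients at `a` and `b` cancel, so both entries may become any common `w`; a third
    -- index keeps the old value and differs from it.
    obtain ⟨w, hw, hwa⟩ := exists_mem_ne hnontriv (x a)
    obtain ⟨e, heC, he⟩ : ∃ e ∈ C, e ∉ ({a, b} : Finset ι) :=
      exists_mem_notMem_of_card_lt_card (card_le_two.trans_lt h3)
    have hea : e ≠ a := fun h => he (by simp [h])
    have heb : e ≠ b := fun h => he (by simp [h])
    obtain ⟨x', h1, h2, h3⟩ := key (Function.update (Function.update x a w) b w) (by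
        intro j hj
        by_cases hjb : j = b
        · subst hjb; simpa using hlevel hw
        · rw [Function.update_of_ne hjb]
          by_cases hja : j = a
          · subst hja; simpa using hlevel hw
          · rw [Function.update_of_ne hja]
            exact hlevel (hx j hj)) a ha e heC (by
        rw [Function.update_of_ne hab, Function.update_self, Function.update_of_ne heb,
          Function.update_of_ne hea, ← hdist a ha e heC]
        exact hwa)
    refine ⟨x', h1, h2, h3.trans (hsplit a ha b hb hab w w ?_)⟩
    rw [← hdist a ha b hb, ← add_smul, ← add_smul, hsum a ha b hb hab, zero_smul, zero_smul]

open Finset in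
/-- Class by class rewriting of linear combinations with pairwise distinct elements. -/
theorem exists_injOn_classes {F : Type*} [Field F] {V : Type*} [AddCommGroup V] [Module F V]
    [DecidableEq V] {ι κ : Type*} [Fintype ι] [DecidableEq κ] (f : ι → κ) (c : ι → F)
    (x : ι → V) (S Z₀ : Finset V) (W : Finset κ)
    (hW : ∀ q ∈ W, ∀ Z : Finset V, Z.card ≤ Z₀.card + Fintype.card ι →
      ∃ x' : ι → V, (∀ j ∈ univ.filter (f · = q), x' j ∈ S ∧ x' j ∉ Z) ∧
        Set.InjOn x' (univ.filter (f · = q) : Finset ι) ∧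
        ∑ j ∈ univ.filter (f · = q), c j • x' j = ∑ j ∈ univ.filter (f · = q), c j • x j) :
    ∃ x' : ι → V, (∀ j, f j ∈ W → x' j ∈ S ∧ x' j ∉ Z₀) ∧
      (∀ i j, f i ∈ W → f j ∈ W → x' i = x' j → i = j) ∧
      ∀ q ∈ W, ∑ j ∈ univ.filter (f · = q), c j • x' j =
        ∑ j ∈ univ.filter (f · = q), c j • x j := by
  classical
  induction W using Finset.induction_on with
  | empty => exact ⟨x, by simp, by simp, by simp⟩
  | insert q W hq ih =>
    obtain ⟨x', h1, h2, h3⟩ := ih fun r hr => hW r (mem_insert_of_mem hr)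
    obtain ⟨y, y1, y2, y3⟩ := hW q (mem_insert_self _ _) (Z₀ ∪ univ.image x') (by
      refine (card_union_le _ _).trans (Nat.add_le_add_left ?_ _)
      exact card_image_le)
    have hyZ : ∀ j, f j = q → y j ∈ S ∧ y j ∉ Z₀ ∧ ∀ i, y j ≠ x' i := by
      intro j hj
      have := y1 j (by simp [hj])
      rw [mem_union, not_or] at this
      exact ⟨this.1, this.2.1, fun i h => this.2.2 (mem_image.2 ⟨i, mem_univ _, h.symm⟩)⟩
    refine ⟨fun j => if f j = q then y j else x' j, ?_, ?_, ?_⟩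
    · intro j hj
      by_cases hjq : f j = q
      · simpa [hjq] using ⟨(hyZ j hjq).1, (hyZ j hjq).2.1⟩
      · simpa [hjq] using h1 j (mem_of_mem_insert_of_ne hj hjq)
    · intro i j hi hj hij
      by_cases hiq : f i = q <;> by_cases hjq : f j = q <;> simp only [hiq, hjq, if_true, if_false] at hij
      · exact y2 (by simp [hiq]) (by simp [hjq]) hij
      · exact absurd hij ((hyZ i hiq).2.2 j)
      · exact absurd hij.symm ((hyZ j hjq).2.2 i)
      · exact h2 i j (mem_of_mem_insert_of_ne hi hiq) (mem_of_mem_insert_of_ne hj hjq) hij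
    · intro r hr
      by_cases hrq : r = q
      · subst hrq
        refine Eq.trans (sum_congr rfl fun j hj => ?_) y3
        simp only [(mem_filter.1 hj).2, if_true]
      · refine Eq.trans (sum_congr rfl fun j hj => ?_) (h3 r (mem_of_mem_insert_of_ne hr hrq))
        simp only [(mem_filter.1 hj).2, hrq, if_false]

/-! ### The part-sum kernel and the final assembly -/

open Finset in
/-- If every nonzero row combination has nonzero sums over two of the parts, then the kernel of the
matrix of part sums is contained in no coordinate hyperplane. -/
theorem exists_kernel_of_two_part_sums {F : Type*} [Field F] {m k s : ℕ}
    (A : Matrix (Fin m) (Fin k) F) (Q : Fin s → Finset (Fin k))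
    (h : ∀ b ∈ LinSys.rowSpace A, b ≠ 0 →
      ∃ r r' : Fin s, r ≠ r' ∧ ∑ j ∈ Q r, b j ≠ 0 ∧ ∑ j ∈ Q r', b j ≠ 0) (r : Fin s) :
    ∃ w : Fin s → F, (∀ i, ∑ r', (∑ j ∈ Q r', A i j) * w r' = 0) ∧ w r ≠ 0 := by
  let L : (Fin k → F) →ₗ[F] (Fin s → F) :=
    { toFun := fun b r => ∑ j ∈ Q r, b j
      map_add' := fun b b' => by
        funext r; simp only [Pi.add_apply, sum_add_distrib]
      map_smul' := fun c b => by
        funext r; simp only [Pi.smul_apply, smul_eq_mul, mul_sum, RingHom.id_apply] }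
  -- A unit vector has a single nonzero part sum. A functional separating it from the image of the
  -- row space is the required `w`.
  have hnot : (Pi.single r 1 : Fin s → F) ∉ (LinSys.rowSpace A).map L := by
    rintro ⟨b, hb, hLb⟩
    have hb0 : b ≠ 0 := by
      rintro rfl
      rw [map_zero] at hLb
      have := congrFun hLb r
      simp at this
    obtain ⟨r₁, r₂, hne, h₁, h₂⟩ := h b hb hb0
    have hr : ∀ r', ∑ j ∈ Q r', b j ≠ 0 → r' = r := by
      intro r' h'
      by_contra hr'
      exact h' ((congrFun hLb r').trans (Pi.single_eq_of_ne hr' _))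
    exact hne ((hr r₁ h₁).trans (hr r₂ h₂).symm)
  obtain ⟨f, hf, hle⟩ := Submodule.exists_le_ker_of_notMem hnot
  refine ⟨fun r' => f (Pi.single r' 1), fun i => ?_, hf⟩
  have h1 : f (L (A.row i)) = 0 :=
    hle (Submodule.mem_map_of_mem (Submodule.subset_span ⟨i, rfl⟩))
  rw [LinearMap.pi_apply_eq_sum_univ f] at h1
  have hsingle : ∀ r' : Fin s, (Pi.single r' 1 : Fin s → F) = fun j => if r' = j then 1 else 0 := by
    intro r'
    funext j
    simp [Pi.single_apply, eq_comm]
  simp only [hsingle]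
  exact h1

open Finset in
theorem mainTheorem6 {F : Type*} [Field F] [Fintype F] {m k : ℕ}
    (A : Matrix (Fin m) (Fin k) F)
    (hRC : LinSys.IsTypeRC A) (hnd : LinSys.IsNondegenerate A) (hirr : ¬ LinSys.IsReducible A)
    {s : ℕ} (P : Fin (s + s) → Finset (Fin k)) (hP : LinSys.IsPartition P)
    (h_zero : ∀ r : Fin s, LinSys.SumsToZero A (P (Fin.castAdd s r) ∪ P (Fin.natAdd s r)))
    (h_two : ∀ b ∈ LinSys.rowSpace A, b ≠ 0 →
      ∃ r r' : Fin s, r ≠ r' ∧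
        ∑ j ∈ P (Fin.castAdd s r), b j ≠ 0 ∧ ∑ j ∈ P (Fin.castAdd s r'), b j ≠ 0)
    (h_pair : ∀ C : Finset (Fin k), LinSys.IsColumnClass A C → C.card = 2 →
      LinSys.SumsToZero A C →
        ∃ r : Fin s, C = P (Fin.castAdd s r) ∪ P (Fin.natAdd s r)) :
    LinSys.IsModerate A := by
  classical
  obtain ⟨hPne, hPdisj, hPcov⟩ := hP
  have hq1 : (1 : ℝ) < Fintype.card F := by exact_mod_cast Fintype.one_lt_card
  obtain ⟨β₁, γ₁, hβ₁, hγ₁, hγ₁q, hpairs⟩ := exists_pairs_of_forall_exists_kernel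
    (fun i r => ∑ j ∈ P (Fin.castAdd s r), A i j)
    (exists_kernel_of_two_part_sums A (fun r => P (Fin.castAdd s r)) h_two)
  -- The avoidance budget is 1 for the singleton class, k for entries of other classes and k for the
  -- current class. The summand 2 and the maximum with 1 give `T k` two elements.
  obtain ⟨β, γ, hβ, hγ, hγq, hchain⟩ := exists_pairRich_chain F (2 * k + 1) k (β₁ + 2) (max γ₁ 1)
    (by positivity) (lt_max_of_lt_left hγ₁) (max_lt hγ₁q hq1)
  refine ⟨β, γ, hβ, hγ, hγq, fun n S hS => ?_⟩
  obtain ⟨T, rfl, hT, hTk⟩ := hchain n S hS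
  have hpow : 1 ≤ max γ₁ 1 ^ n := one_le_pow₀ (le_max_right _ _)
  have hTk2 : 2 ≤ (T k).card := by
    have : (2 : ℝ) ≤ (T k).card := by nlinarith
    exact_mod_cast this
  obtain ⟨y, z, hyz, hsol⟩ := hpairs n (T k) (by
    have : γ₁ ^ n ≤ max γ₁ 1 ^ n := pow_le_pow_left₀ hγ₁.le (le_max_left _ _) n
    nlinarith)
  choose p hp using hPcov
  have hpuniq : ∀ j r, j ∈ P r → p j = r := fun j r hj => by
    by_contra hne
    exact disjoint_left.1 (hPdisj _ _ hne) (hp j) hj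
  have hPp : ∀ r, univ.filter (p · = r) = P r := by
    intro r
    ext j
    simp only [mem_filter, mem_univ, true_and]
    exact ⟨fun h => h ▸ hp j, hpuniq j r⟩
  have hPdisj' : ∀ r : Fin s, Disjoint (P (Fin.castAdd s r)) (P (Fin.natAdd s r)) := fun r =>
    hPdisj _ _ fun h => by
      have := congrArg Fin.val h
      simp only [Fin.val_castAdd, Fin.val_natAdd] at this
      have := r.2
      omega
  let x : Fin k → Fin n → F := fun j => Fin.append y z (p j)
  have hxl : ∀ r : Fin s, ∀ j ∈ P (Fin.castAdd s r), x j = y r := fun r j hj => by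
    simp only [x, hpuniq j _ hj, Fin.append_left]
  have hxr : ∀ r : Fin s, ∀ j ∈ P (Fin.natAdd s r), x j = z r := fun r j hj => by
    simp only [x, hpuniq j _ hj, Fin.append_right]
  have hxT : ∀ j, x j ∈ T k := by
    intro j
    have hall : ∀ r, Fin.append y z r ∈ T k := fun r => by
      refine Fin.addCases (fun r => ?_) (fun r => ?_) r
      · rw [Fin.append_left]; exact (hyz r).1
      · rw [Fin.append_right]; exact (hyz r).2.1
    exact hall _
  have hxsol : LinSys.IsSolution A x := by
    intro i
    rw [← sum_fiberwise univ p, Fin.sum_univ_add, ← sum_add_distrib, ← hsol i]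
    refine sum_congr rfl fun r _ => ?_
    rw [hPp, hPp, sum_congr rfl fun j hj => by rw [hxl r j hj],
      sum_congr (s₁ := P (Fin.natAdd s r)) rfl fun j hj => by rw [hxr r j hj],
      ← sum_smul, ← sum_smul]
    have h0 := congrFun (h_zero r) i
    rw [sum_union (hPdisj' r)] at h0
    simp only [Pi.add_apply, Finset.sum_apply, Matrix.col_apply, Pi.zero_apply] at h0
    rw [eq_neg_of_add_eq_zero_right h0, neg_smul, smul_sub, sub_eq_add_neg]
  let f : Fin k → Quotient (LinSys.columnSetoid A) := Quotient.mk _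
  have hrep : ∀ j, ∃ c : F, c ≠ 0 ∧ A.col j = c • A.col (f j).out := fun j =>
    Quotient.exact (Quotient.out_eq (f j))
  choose c hc0 hc using hrep
  have hclass : ∀ j, LinSys.IsColumnClass A (univ.filter (f · = f j)) := by
    intro j
    refine ⟨j, ?_⟩
    ext i
    simp only [coe_filter, mem_univ, true_and, Set.mem_ofPred_eq]
    exact Quotient.eq
  let W : Finset (Quotient (LinSys.columnSetoid A)) :=
    univ.filter fun q => 2 ≤ (univ.filter (f · = q)).card
  have hsmall : ∀ i j, f i ∉ W → f j ∉ W → i = j := by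
    have hone : ∀ j, f j ∉ W → (univ.filter (f · = f j)).card = 1 := by
      intro j hj
      have h1 : 0 < (univ.filter (f · = f j)).card := card_pos.2 ⟨j, by simp⟩
      have h2 : ¬ 2 ≤ (univ.filter (f · = f j)).card := fun h => hj (by simpa [W] using h)
      omega
    intro i j hi hj
    have heq := hRC.2 _ _ (hclass i) (hclass j) (hone i hi) (hone j hj)
    have hi' : i ∈ univ.filter (f · = f j) := heq ▸ (by simp)
    exact card_le_one.1 (hone j hj).le i hi' j (by simp)
  -- The entry of the singleton class cannot be exchanged, so all new entries must avoid it.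
  let Z₀ : Finset (Fin n → F) := (univ.filter fun j => f j ∉ W).image x
  have hZ₀ : Z₀.card ≤ 1 := by
    refine card_image_le.trans (card_le_one.2 fun i hi j hj => ?_)
    exact hsmall i j (mem_filter.1 hi).2 (mem_filter.1 hj).2
  obtain ⟨x', hx'S, hx'inj, hx'sum⟩ := exists_injOn_classes f c x (T 0) Z₀ W (by
    intro q hq Z hZ
    have hcard := (mem_filter.1 hq).2
    have hle : (univ.filter (f · = q)).card ≤ k := by simpa using card_le_univ (univ.filter (f · = q))
    have hTsub : T k ⊆ T (univ.filter (f · = q)).card := PairRich.chain_subset hT hle le_rfl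
    rw [Fintype.card_fin] at hZ
    refine exists_injOn_of_two_le_card T c hc0 _ (fun i hi => hT i (by omega)) hcard
      (hTk2.trans (card_le_card hTsub)) x (fun j _ => hTsub (hxT j)) ?_ Z (by omega)
    intro h2 hsum a ha b hb hab
    have hclassq : LinSys.IsColumnClass A (univ.filter (f · = q)) :=
      (mem_filter.1 ha).2 ▸ hclass a
    obtain ⟨r, hr⟩ := h_pair _ hclassq h2 (by
      unfold LinSys.SumsToZero
      have : ∀ j ∈ univ.filter (f · = q), A.col j = c j • A.col q.out := fun j hj => by
        rw [hc j, (mem_filter.1 hj).2]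
      rw [sum_congr rfl this, ← sum_smul, hsum, zero_smul])
    -- Both parts are nonempty, hence singletons, so the two entries are `y r` and `z r`.
    have hcards : (P (Fin.castAdd s r)).card + (P (Fin.natAdd s r)).card = 2 := by
      rw [← card_union_of_disjoint (hPdisj' r), ← hr, h2]
    have hc1 := card_pos.2 (hPne (Fin.castAdd s r))
    have hc2 := card_pos.2 (hPne (Fin.natAdd s r))
    rw [hr, mem_union] at ha hb
    rcases ha with ha | ha <;> rcases hb with hb | hb
    · exact absurd (card_le_one.1 (by omega) a ha b hb) hab
    · rw [hxl r a ha, hxr r b hb]; exact (hyz r).2.2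
    · rw [hxr r a ha, hxl r b hb]; exact (hyz r).2.2.symm
    · exact absurd (card_le_one.1 (by omega) a ha b hb) hab)
  refine ⟨fun j => if f j ∈ W then x' j else x j, fun j => ?_, fun i => ?_, fun i j hij => ?_⟩
  · by_cases hj : f j ∈ W
    · simpa [hj] using (hx'S j hj).1
    · simpa [hj] using PairRich.chain_subset hT (Nat.zero_le k) le_rfl (hxT j)
  · rw [← hxsol i, ← sum_fiberwise univ f, ← sum_fiberwise univ f (fun j => A i j • x j)]
    refine sum_congr rfl fun q _ => ?_
    by_cases hq : q ∈ W
    · have hA : ∀ j ∈ univ.filter (f · = q), A i j = A i q.out * c j := fun j hj => by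
        have := congrFun (hc j) i
        rw [(mem_filter.1 hj).2] at this
        simpa [mul_comm] using this
      calc ∑ j ∈ univ.filter (f · = q), A i j • (if f j ∈ W then x' j else x j)
          = A i q.out • ∑ j ∈ univ.filter (f · = q), c j • x' j := by
            rw [smul_sum]
            refine sum_congr rfl fun j hj => ?_
            rw [hA j hj, if_pos ((mem_filter.1 hj).2 ▸ hq), mul_smul]
        _ = ∑ j ∈ univ.filter (f · = q), A i j • x j := by
            rw [hx'sum q hq, smul_sum]
            refine sum_congr rfl fun j hj => ?_
            rw [hA j hj, mul_smul]
    · refine sum_congr rfl fun j hj => ?_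
      simp only [(mem_filter.1 hj).2, hq, if_false]
  · by_cases hi : f i ∈ W <;> by_cases hj : f j ∈ W <;>
      simp only [hi, hj, if_true, if_false] at hij
    · exact hx'inj i j hi hj hij
    · exact absurd (hij ▸ mem_image_of_mem x (by simp [hj])) (hx'S i hi).2
    · exact absurd (hij.symm ▸ mem_image_of_mem x (by simp [hi])) (hx'S j hj).2
    · exact hsmall i j hi hj
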